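/- Let $g:[0,\infty)\to[0,\infty)$ be continuous and nondecreasing, and suppose that $g(x)=x$ has exactly two solutions in $[0,\infty)$, namely $0$ and $\kappa>0$; that $g$ is Lipschitz on $[0,\kappa]$ and $C^1$ in some $\delta_0$-neighbourhoods (relative to $[0,\infty)$) of $0$ and $\kappa$, with $g'(0)>1$, $g'(\kappa)<1$; and that $|g'(u)-g'(0)|+|g'(\kappa)-g'(\kappa-u)|\le Cu^{\theta}$ for small $u>0$, with some $C>0$, $\theta\in(0,1]$. For $h\ge 0$ consider $$u_t(t,x)=u_{xx}(t,x)-u(t,x)+g(u(t-h,x)),\qquad t,x\in\mathbb R. \tag{1}$$ A wavefront of speed $c>0$ is a solution $u(t,x)=\phi(x+ct)$ of (1) with $\phi\in C^2(\mathbb R)$, $\phi>0$, $\phi(-\infty)=0$, $\phi(+\infty)=\kappa$. Let $c_*=c_*(h)$ denote the smallest $c>0$ for which a wavefront of speed $c$ exists, and let $c_\#=c_\#(h)$ be the unique real $c$ for which $\chi(z,c)=z^2-cz-1+g'(0)e^{-zch}$ has a positive double zero in $z$. For $c>c_\#$ let $\lambda_1(c)<\lambda_2(c)$ be the two positive zeros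 of $\chi(\cdot,c)$. A wavefront is called pushed if its speed is $c_*$ and $c_*>c_\#$. Suppose that, for some $h_0\ge 0$, equation (1) with delay $h=h_0$ has a pushed wavefront. Then there is $\delta>0$ such that, for every $h\ge 0$ with $h\in(h_0-\delta,h_0+\delta)$, equation (1) with delay $h$ has a pushed wavefront. Moreover, for some $h>0$ in $(h_0-\delta,h_0+\delta)$, equation (1) has a pushed wavefront $\phi(x+c_*t)$ whose profile $\phi$ is strictly increasing and satisfies, for some $s_0\in\mathbb R$ and $\varsigma>0$, $$\phi(t+s_0)=e^{\lambda_2 t}+O\big(e^{(\lambda_2+\varsigma)t}\big),\quad t\to-\infty,\qquad \lambda_2=\lambda_2(c_*). \tag{2}$$ In particular, there exist a function $g$ as above and a delay $h>0$ for which equation (1) has a pushed wavefront with strictly increasing profile satisfying (2). -/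

import Mathlib

open Set Filter Topology Asymptotics
open scoped NNReal

namespace DelayedFront

/-- Derivative of `g : ℝ₊ → ℝ₊`: right derivative at `0`, ordinary derivative at positive points.
The birth function is represented by a function on `ℝ` of which only the values on `[0, ∞)` matter. -/
noncomputable def birthDeriv (g : ℝ → ℝ) (u : ℝ) : ℝ := derivWithin g (Ici 0) u

/-- The monostability hypothesis on the birth function `g : ℝ₊ → ℝ₊` with positive equilibrium `κ`. -/
structure Monostable (g : ℝ → ℝ) (κ : ℝ) : Prop where
  kappa_pos : 0 < κ
  mapsTo : MapsTo g (Ici 0) (Ici 0)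
  continuousOn : ContinuousOn g (Ici 0)
  fixed_iff : ∀ u, 0 ≤ u → (g u = u ↔ u = 0 ∨ u = κ)
  lipschitz : ∃ L : ℝ≥0, LipschitzOnWith L g (Icc 0 κ)
  one_lt_deriv_zero : 1 < birthDeriv g 0
  deriv_kappa_lt_one : birthDeriv g κ < 1
  regular : ∃ δ₀ : ℝ, 0 < δ₀ ∧ δ₀ ≤ κ ∧
    ContDiffOn ℝ 1 g (Ico 0 δ₀) ∧ ContDiffOn ℝ 1 g (Ioo (κ - δ₀) (κ + δ₀)) ∧
    ∃ C θ : ℝ, 0 < C ∧ 0 < θ ∧ θ ≤ 1 ∧ ∀ u ∈ Ioo 0 δ₀,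
      |birthDeriv g u - birthDeriv g 0| + |birthDeriv g κ - birthDeriv g (κ - u)| ≤ C * u ^ θ

/-- `u` solves `u_t(t,x) = u_xx(t,x) - u(t,x) + g(u(t-h,x))` at every `(t,x) ∈ ℝ × ℝ`
(the regularity of `u` is imposed separately). -/
def SolvesDelayedEquation (g : ℝ → ℝ) (h : ℝ) (u : ℝ → ℝ → ℝ) : Prop :=
  ∀ t x : ℝ, deriv (fun s => u s x) t
    = iteratedDeriv 2 (fun y => u t y) x - u t x + g (u (t - h) x)

/-- `u(t,x) = φ(x + ct)` is a wavefront: a classical positive solution whose profile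
connects `0` at `-∞` with `κ` at `+∞`. -/
structure IsWavefront (g : ℝ → ℝ) (κ h c : ℝ) (φ : ℝ → ℝ) : Prop where
  smooth : ContDiff ℝ 2 φ
  pos : ∀ s, 0 < φ s
  solves : SolvesDelayedEquation g h (fun t x => φ (x + c * t))
  tendsto_atBot : Tendsto φ atBot (𝓝 0)
  tendsto_atTop : Tendsto φ atTop (𝓝 κ)

/-- The set of admissible (positive) wavefront speeds. -/
def admissibleSpeeds (g : ℝ → ℝ) (κ h : ℝ) : Set ℝ :=
  {c | 0 < c ∧ ∃ φ, IsWavefront g κ h c φ}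

/-- `c` is the minimal speed of propagation `c_*`. -/
def IsMinimalSpeed (g : ℝ → ℝ) (κ h c : ℝ) : Prop := IsLeast (admissibleSpeeds g κ h) c

/-- The characteristic function `χ(z,c) = z² - cz - 1 + p e^{-zch}` (with `p = g'(0)`). -/
noncomputable def charFun (p h c z : ℝ) : ℝ :=
  z ^ 2 - c * z - 1 + p * Real.exp (-(z * c * h))

/-- `c` is the linearly determined speed `c_#`: `χ(·,c)` has a positive double zero. (The second
derivative of `χ(·,c)` is everywhere positive when `p > 0`, so such a zero is exactly double.) -/
def IsLinearSpeed (p h c : ℝ) : Prop :=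
  ∃ z : ℝ, 0 < z ∧ charFun p h c z = 0 ∧ deriv (charFun p h c) z = 0

/-- `u(t,x) = φ(x + ct)` is a pushed front: a wavefront of minimal speed `c = c_*` with `c_* > c_#`. -/
def IsPushedFront (g : ℝ → ℝ) (κ h c : ℝ) (φ : ℝ → ℝ) : Prop :=
  IsWavefront g κ h c φ ∧ IsMinimalSpeed g κ h c ∧
    ∃ cs : ℝ, IsLinearSpeed (birthDeriv g 0) h cs ∧ cs < c

/-- `l₁ < l₂` are all the positive zeros of `χ(·,c)`. -/
def ArePositiveRoots (p h c l₁ l₂ : ℝ) : Prop :=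
  0 < l₁ ∧ l₁ < l₂ ∧ ∀ z : ℝ, 0 < z → (charFun p h c z = 0 ↔ z = l₁ ∨ z = l₂)

/-- `φ(t + s₀) = e^{λ₂ t} + O(e^{(λ₂ + ς) t})` as `t → -∞`, for some `s₀ ∈ ℝ` and `ς > 0`, where
`λ₂` is the larger one of the two positive zeros of `χ(·,c)`. -/
def HasPushedAsymptotics (g : ℝ → ℝ) (h c : ℝ) (φ : ℝ → ℝ) : Prop :=
  ∃ l₁ l₂ : ℝ, ArePositiveRoots (birthDeriv g 0) h c l₁ l₂ ∧
    ∃ s₀ ς : ℝ, 0 < ς ∧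
      (fun t => φ (t + s₀) - Real.exp (l₂ * t)) =O[atBot] (fun t => Real.exp ((l₂ + ς) * t))

end DelayedFront

/-!
Writing the profile equation as `φ'' - c φ' - φ + g (φ (· - ch)) = 0` and inverting
`φ ↦ φ + c φ' - φ''`, monotone fronts become fixed points of an order preserving integral operator.
A supersolution therefore yields a front of the same speed, so the set of front speeds is an up-set,
and by compactness it is closed, also jointly in `h` and `c`.

If a front decays at `-∞` more slowly than `e ^ (z t)` for some `z` with `χ(z, c) < 0`, then it can
be stretched and glued to a small multiple of `e ^ (z t)`, which gives a supersolution at a smaller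
speed. So a front of minimal speed `c > c_#` decays at least like such an exponential, and the
linearized equation then leaves only the rate `λ₂`. A pushed front thus exists as soon as some speed
above `c_#` carries no front, and by closedness this condition is stable under perturbations of `h`.

For the example, take `h = 0`: multiplying the profile equation by `φ'` and integrating bounds
`∫₀^κ (g u - u) du` in terms of `c`, which excludes slow fronts when `g` is large away from `0`.
-/

namespace DelayedFront

open MeasureTheory

section ExpIntegral

variable {μ M : ℝ} {f f₁ f₂ b : ℝ → ℝ}

/-- The exponentially weighted integral `∫₀^∞ e^{-μ s} f(s) ds`, from which the Green's function of
`u'' - cu' - u` is assembled. -/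
noncomputable def expIntegral (μ : ℝ) (f : ℝ → ℝ) : ℝ :=
  ∫ s in Ioi (0 : ℝ), Real.exp (-(μ * s)) * f s

lemma integrableOn_exp_neg_mul (hμ : 0 < μ) :
    IntegrableOn (fun s => Real.exp (-(μ * s))) (Ioi (0 : ℝ)) := by
  simpa only [neg_mul] using exp_neg_integrableOn_Ioi 0 hμ

lemma integrableOn_exp_neg_mul_mul (hμ : 0 < μ) (hf : Measurable f) (hM : ∀ s, |f s| ≤ M) :
    IntegrableOn (fun s => Real.exp (-(μ * s)) * f s) (Ioi (0 : ℝ)) :=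
  (integrableOn_exp_neg_mul hμ).mul_bdd hf.aestronglyMeasurable (Eventually.of_forall hM)

lemma expIntegral_const (hμ : 0 < μ) (M : ℝ) : expIntegral μ (fun _ => M) = M / μ := by
  have h := integral_exp_mul_Ioi (neg_lt_zero.2 hμ) 0
  simp only [neg_mul, mul_zero, Real.exp_zero] at h
  rw [expIntegral, integral_mul_const, h]
  ring

lemma expIntegral_nonneg (h0 : ∀ s, 0 ≤ f s) : 0 ≤ expIntegral μ f :=
  integral_nonneg fun s => mul_nonneg (Real.exp_pos _).le (h0 s)

lemma expIntegral_mono (hμ : 0 < μ) (hf₁ : Measurable f₁) (hf₂ : Measurable f₂)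
    (hM₁ : ∀ s, |f₁ s| ≤ M) (hM₂ : ∀ s, |f₂ s| ≤ M) (hle : ∀ s, f₁ s ≤ f₂ s) :
    expIntegral μ f₁ ≤ expIntegral μ f₂ :=
  integral_mono (integrableOn_exp_neg_mul_mul hμ hf₁ hM₁) (integrableOn_exp_neg_mul_mul hμ hf₂ hM₂)
    fun s => mul_le_mul_of_nonneg_left (hle s) (Real.exp_pos _).le

lemma abs_expIntegral_le (hμ : 0 < μ) (hM : ∀ s, |f s| ≤ M) : |expIntegral μ f| ≤ M / μ := by
  rw [← expIntegral_const hμ]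
  refine norm_integral_le_of_norm_le (f := fun s => Real.exp (-(μ * s)) * f s)
    ((integrableOn_exp_neg_mul hμ).mul_const M) (Eventually.of_forall fun s => ?_)
  rw [norm_mul, Real.norm_of_nonneg (Real.exp_pos _).le]
  exact mul_le_mul_of_nonneg_left (hM s) (Real.exp_pos _).le

lemma tendsto_expIntegral {ι : Type*} {l : Filter ι} [l.IsCountablyGenerated] {μ : ι → ℝ} {μ₀ : ℝ}
    (hμ₀ : 0 < μ₀) (hμ : Tendsto μ l (𝓝 μ₀)) {f : ι → ℝ → ℝ} {f₀ : ℝ → ℝ}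
    (hf : ∀ i, Measurable (f i)) (hM : ∀ i s, |f i s| ≤ M)
    (hlim : ∀ s, Tendsto (fun i => f i s) l (𝓝 (f₀ s))) :
    Tendsto (fun i => expIntegral (μ i) (f i)) l (𝓝 (expIntegral μ₀ f₀)) := by
  refine tendsto_integral_filter_of_dominated_convergence
    (fun s => Real.exp (-(μ₀ / 2 * s)) * M) ?_ ?_ ?_ ?_
  · have hexp : ∀ i, Measurable fun s : ℝ => Real.exp (-(μ i * s)) := fun i => by fun_prop
    exact Eventually.of_forall fun i => ((hexp i).mul (hf i)).aestronglyMeasurable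
  · filter_upwards [hμ.eventually_const_lt (half_lt_self hμ₀)] with i hi
    refine (ae_restrict_iff' measurableSet_Ioi).2 (Eventually.of_forall fun s (hs : 0 < s) => ?_)
    rw [norm_mul, Real.norm_of_nonneg (Real.exp_pos _).le]
    refine mul_le_mul ?_ (hM i s) (norm_nonneg _) (Real.exp_pos _).le
    gcongr
  · exact (integrableOn_exp_neg_mul (half_pos hμ₀)).mul_const M
  · exact Eventually.of_forall fun s =>
      ((Real.continuous_exp.tendsto _).comp (hμ.mul_const s).neg).mul (hlim s)

lemma expIntegral_comp_sub_left (μ : ℝ) (b : ℝ → ℝ) (t : ℝ) :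
    expIntegral μ (fun s => b (t - s)) =
      Real.exp (-(μ * t)) * ∫ r in Iic t, Real.exp (μ * r) * b r := by
  have h := integral_comp_neg_Ioi 0 fun u => Real.exp (μ * u) * b (t + u)
  simp only [mul_neg, ← sub_eq_add_neg, neg_zero] at h
  rw [expIntegral, h, ← integral_const_mul]
  have hshift := (measurePreserving_add_left volume t).setIntegral_preimage_emb
    (measurableEmbedding_addLeft t)
    (fun r => Real.exp (-(μ * t)) * (Real.exp (μ * r) * b r)) (Iic t)
  rw [← hshift, preimage_const_add_Iic, sub_self]
  congr 1 with u
  rw [← mul_assoc, ← Real.exp_add]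
  ring_nf

lemma hasDerivAt_integral_Iic {F : ℝ → ℝ} (hF : Continuous F) (hint : ∀ x, IntegrableOn F (Iic x))
    (t : ℝ) : HasDerivAt (fun x => ∫ r in Iic x, F r) (F t) t := by
  have hsplit : ∀ x, ∫ r in Iic x, F r = (∫ r in Iic 0, F r) + ∫ r in 0..x, F r := fun x => by
    rw [← intervalIntegral.integral_Iic_sub_Iic (hint 0) (hint x)]
    ring
  rw [funext hsplit]
  exact (intervalIntegral.integral_hasDerivAt_right (hF.intervalIntegrable _ _)
    (hF.stronglyMeasurableAtFilter _ _) hF.continuousAt).const_add _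

lemma hasDerivAt_expIntegral_past (hμ : 0 < μ) (hb : Continuous b) (hM : ∀ s, |b s| ≤ M) (t : ℝ) :
    HasDerivAt (fun t => expIntegral μ fun s => b (t - s))
      (b t - μ * expIntegral μ fun s => b (t - s)) t := by
  have hint : ∀ x, IntegrableOn (fun r => Real.exp (μ * r) * b r) (Iic x) := fun x =>
    (integrableOn_exp_mul_Iic hμ x).mul_bdd hb.aestronglyMeasurable (Eventually.of_forall hM)
  have hexp : HasDerivAt (fun x => Real.exp (-(μ * x))) (Real.exp (-(μ * t)) * -(μ * 1)) t :=
    ((hasDerivAt_id t).const_mul μ).neg.exp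
  have hinv : Real.exp (-(μ * t)) * Real.exp (μ * t) = 1 := by rw [← Real.exp_add]; simp
  simp_rw [expIntegral_comp_sub_left]
  exact (hexp.mul (hasDerivAt_integral_Iic (by fun_prop) hint t)).congr_deriv
    (by linear_combination b t * hinv)

lemma hasDerivAt_expIntegral_future (hμ : 0 < μ) (hb : Continuous b) (hM : ∀ s, |b s| ≤ M)
    (t : ℝ) : HasDerivAt (fun t => expIntegral μ fun s => b (t + s))
      (μ * expIntegral μ (fun s => b (t + s)) - b t) t := by
  have h := (hasDerivAt_expIntegral_past hμ (hb.comp continuous_neg) (fun s => hM _) (-t)).scomp t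
    (hasDerivAt_neg t)
  simp only [Function.comp_def, neg_sub, neg_neg, sub_neg_eq_add, smul_eq_mul,
    add_comm _ (_ : ℝ)] at h ⊢
  exact h.congr_deriv (by ring)

end ExpIntegral

/-- The rate at which the Green's function of `u'' - cu' - u` decays at `+∞`: minus the negative
root of `z² - cz - 1`. -/
noncomputable def decayRate (c : ℝ) : ℝ := (√(c ^ 2 + 4) - c) / 2

/-- The rate at which the Green's function of `u'' - cu' - u` grows at `-∞`: the positive root of
`z² - cz - 1`. -/
noncomputable def growthRate (c : ℝ) : ℝ := (√(c ^ 2 + 4) + c) / 2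

lemma abs_lt_sqrt_sq_add_four (c : ℝ) : |c| < √(c ^ 2 + 4) := by
  rw [← Real.sqrt_sq_eq_abs]
  exact Real.sqrt_lt_sqrt (sq_nonneg c) (by linarith)

lemma decayRate_pos (c : ℝ) : 0 < decayRate c :=
  div_pos (sub_pos.2 ((le_abs_self c).trans_lt (abs_lt_sqrt_sq_add_four c))) two_pos

lemma growthRate_pos (c : ℝ) : 0 < growthRate c :=
  div_pos (by linarith [neg_le_abs c, abs_lt_sqrt_sq_add_four c]) two_pos

lemma growthRate_sub_decayRate (c : ℝ) : growthRate c - decayRate c = c := by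
  unfold growthRate decayRate; ring

lemma decayRate_mul_growthRate (c : ℝ) : decayRate c * growthRate c = 1 := by
  have : √(c ^ 2 + 4) ^ 2 = c ^ 2 + 4 := Real.sq_sqrt (by positivity)
  unfold growthRate decayRate; linear_combination this / 4

lemma decayRate_add_growthRate_pos (c : ℝ) : 0 < decayRate c + growthRate c :=
  add_pos (decayRate_pos c) (growthRate_pos c)

lemma two_le_decayRate_add_growthRate (c : ℝ) : 2 ≤ decayRate c + growthRate c := by
  nlinarith [decayRate_mul_growthRate c, sq_nonneg (decayRate c - growthRate c),
    decayRate_add_growthRate_pos c]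

lemma continuous_decayRate : Continuous decayRate := by unfold decayRate; fun_prop

lemma continuous_growthRate : Continuous growthRate := by unfold growthRate; fun_prop

section Resolvent

variable {c M r : ℝ} {b b₁ b₂ : ℝ → ℝ}

/-- The bounded solution `u` of `u'' - cu' - u = -b`, written with the Green's function. -/
noncomputable def resolvent (c : ℝ) (b : ℝ → ℝ) (t : ℝ) : ℝ :=
  (expIntegral (decayRate c) (fun s => b (t - s)) + expIntegral (growthRate c) (fun s => b (t + s)))
    / (decayRate c + growthRate c)

/-- The derivative of `resolvent c b`, as an explicit integral, which makes it accessible to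
estimates and to a second differentiation. -/
noncomputable def resolventDeriv (c : ℝ) (b : ℝ → ℝ) (t : ℝ) : ℝ :=
  (growthRate c * expIntegral (growthRate c) (fun s => b (t + s))
    - decayRate c * expIntegral (decayRate c) (fun s => b (t - s))) / (decayRate c + growthRate c)

lemma resolvent_const (c M t : ℝ) : resolvent c (fun _ => M) t = M := by
  have hα := decayRate_pos c
  have hβ := growthRate_pos c
  rw [resolvent, expIntegral_const hα, expIntegral_const hβ, div_add_div _ _ hα.ne' hβ.ne',
    decayRate_mul_growthRate]
  field_simp
  ring

lemma resolvent_nonneg (h0 : ∀ s, 0 ≤ b s) (t : ℝ) : 0 ≤ resolvent c b t :=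
  div_nonneg (add_nonneg (expIntegral_nonneg fun _ => h0 _) (expIntegral_nonneg fun _ => h0 _))
    (decayRate_add_growthRate_pos c).le

lemma expIntegral_past_mono (hb₁ : Measurable b₁) (hb₂ : Measurable b₂) (hM₁ : ∀ s, |b₁ s| ≤ M)
    (hM₂ : ∀ s, |b₂ s| ≤ M) (hle : ∀ s, b₁ s ≤ b₂ s) {μ : ℝ} (hμ : 0 < μ) (t : ℝ) :
    expIntegral μ (fun s => b₁ (t - s)) ≤ expIntegral μ (fun s => b₂ (t - s)) :=
  expIntegral_mono hμ (hb₁.comp (by fun_prop)) (hb₂.comp (by fun_prop)) (fun _ => hM₁ _)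
    (fun _ => hM₂ _) fun _ => hle _

lemma expIntegral_future_mono (hb₁ : Measurable b₁) (hb₂ : Measurable b₂) (hM₁ : ∀ s, |b₁ s| ≤ M)
    (hM₂ : ∀ s, |b₂ s| ≤ M) (hle : ∀ s, b₁ s ≤ b₂ s) {μ : ℝ} (hμ : 0 < μ) (t : ℝ) :
    expIntegral μ (fun s => b₁ (t + s)) ≤ expIntegral μ (fun s => b₂ (t + s)) :=
  expIntegral_mono hμ (hb₁.comp (by fun_prop)) (hb₂.comp (by fun_prop)) (fun _ => hM₁ _)
    (fun _ => hM₂ _) fun _ => hle _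

lemma resolvent_mono (hb₁ : Measurable b₁) (hb₂ : Measurable b₂) (hM₁ : ∀ s, |b₁ s| ≤ M)
    (hM₂ : ∀ s, |b₂ s| ≤ M) (hle : ∀ s, b₁ s ≤ b₂ s) (t : ℝ) :
    resolvent c b₁ t ≤ resolvent c b₂ t :=
  div_le_div_of_nonneg_right
    (add_le_add (expIntegral_past_mono hb₁ hb₂ hM₁ hM₂ hle (decayRate_pos c) t)
      (expIntegral_future_mono hb₁ hb₂ hM₁ hM₂ hle (growthRate_pos c) t))
    (decayRate_add_growthRate_pos c).le

lemma resolvent_le (hb : Measurable b) (hM : ∀ s, |b s| ≤ M) (t : ℝ) : resolvent c b t ≤ M := by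
  rw [← resolvent_const c M t]
  have hM0 : 0 ≤ M := (abs_nonneg _).trans (hM 0)
  exact resolvent_mono hb measurable_const hM (fun _ => (abs_of_nonneg hM0).le)
    (fun s => (le_abs_self _).trans (hM s)) t

lemma resolvent_add_right (c : ℝ) (b : ℝ → ℝ) (t τ : ℝ) :
    resolvent c b (t + τ) = resolvent c (fun s => b (s + τ)) t := by
  simp only [resolvent]
  congr 3 <;> · ext s; ring_nf

lemma tendsto_resolvent {ι : Type*} {l : Filter ι} [l.IsCountablyGenerated] {c : ι → ℝ} {c₀ : ℝ}
    (hc : Tendsto c l (𝓝 c₀)) {b : ι → ℝ → ℝ} {b₀ : ℝ → ℝ} (hb : ∀ i, Measurable (b i))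
    (hM : ∀ i s, |b i s| ≤ M) (hlim : ∀ s, Tendsto (fun i => b i s) l (𝓝 (b₀ s))) (t : ℝ) :
    Tendsto (fun i => resolvent (c i) (b i) t) l (𝓝 (resolvent c₀ b₀ t)) := by
  have hα := (continuous_decayRate.tendsto c₀).comp hc
  have hβ := (continuous_growthRate.tendsto c₀).comp hc
  refine Tendsto.div (Tendsto.add ?_ ?_) (hα.add hβ) (decayRate_add_growthRate_pos c₀).ne'
  · exact tendsto_expIntegral (decayRate_pos c₀) hα (fun i => (hb i).comp (by fun_prop))
      (fun i _ => hM i _) fun _ => hlim _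
  · exact tendsto_expIntegral (growthRate_pos c₀) hβ (fun i => (hb i).comp (by fun_prop))
      (fun i _ => hM i _) fun _ => hlim _

lemma tendsto_resolvent_of_translates {l : Filter ℝ} [l.IsCountablyGenerated] (hb : Measurable b)
    (hM : ∀ s, |b s| ≤ M) (hr : ∀ s, Tendsto (fun τ => b (s + τ)) l (𝓝 r)) :
    Tendsto (resolvent c b) l (𝓝 r) := by
  have := tendsto_resolvent (c := fun _ : ℝ => c) tendsto_const_nhds
    (fun τ => hb.comp (measurable_id.add_const τ)) (fun _ _ => hM _) hr 0
  simpa only [resolvent_const, ← resolvent_add_right, zero_add, Function.comp_def, id] using this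

lemma tendsto_resolvent_atTop (hb : Measurable b) (hM : ∀ s, |b s| ≤ M)
    (hr : Tendsto b atTop (𝓝 r)) : Tendsto (resolvent c b) atTop (𝓝 r) :=
  tendsto_resolvent_of_translates hb hM fun s =>
    hr.comp (tendsto_atTop_add_const_left _ s tendsto_id)

lemma tendsto_resolvent_atBot (hb : Measurable b) (hM : ∀ s, |b s| ≤ M)
    (hr : Tendsto b atBot (𝓝 r)) : Tendsto (resolvent c b) atBot (𝓝 r) :=
  tendsto_resolvent_of_translates hb hM fun s =>
    hr.comp (tendsto_atBot_add_const_left _ s tendsto_id)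

lemma hasDerivAt_resolvent (hb : Continuous b) (hM : ∀ s, |b s| ≤ M) (t : ℝ) :
    HasDerivAt (resolvent c b) (resolventDeriv c b t) t := by
  refine (((hasDerivAt_expIntegral_past (decayRate_pos c) hb hM t).add
    (hasDerivAt_expIntegral_future (growthRate_pos c) hb hM t)).div_const _).congr_deriv ?_
  rw [resolventDeriv]
  ring

lemma hasDerivAt_resolventDeriv (hb : Continuous b) (hM : ∀ s, |b s| ≤ M) (t : ℝ) :
    HasDerivAt (resolventDeriv c b) (c * resolventDeriv c b t + resolvent c b t - b t) t := by
  refine ((((hasDerivAt_expIntegral_future (growthRate_pos c) hb hM t).const_mul _).sub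
    ((hasDerivAt_expIntegral_past (decayRate_pos c) hb hM t).const_mul _)).div_const
      _).congr_deriv ?_
  rw [resolventDeriv, resolvent]
  have hsum := decayRate_add_growthRate_pos c
  have hprod := decayRate_mul_growthRate c
  have hdiff := growthRate_sub_decayRate c
  generalize expIntegral (growthRate c) (fun s => b (t + s)) = F
  generalize expIntegral (decayRate c) (fun s => b (t - s)) = E
  generalize decayRate c = α at *
  generalize growthRate c = β at *
  subst hdiff
  field_simp
  linear_combination (F + E) * hprod

lemma growthRate_mul_resolvent_sub (c : ℝ) (b : ℝ → ℝ) (t : ℝ) :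
    growthRate c * resolvent c b t - resolventDeriv c b t =
      expIntegral (decayRate c) fun s => b (t - s) := by
  have := (decayRate_add_growthRate_pos c).ne'
  rw [resolvent, resolventDeriv]
  field_simp
  ring

lemma decayRate_mul_resolvent_add (c : ℝ) (b : ℝ → ℝ) (t : ℝ) :
    decayRate c * resolvent c b t + resolventDeriv c b t =
      expIntegral (growthRate c) fun s => b (t + s) := by
  have := (decayRate_add_growthRate_pos c).ne'
  rw [resolvent, resolventDeriv]
  field_simp
  ring

lemma resolventDeriv_le (h0 : ∀ s, 0 ≤ b s) (t : ℝ) :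
    resolventDeriv c b t ≤ growthRate c * resolvent c b t :=
  sub_nonneg.1 (growthRate_mul_resolvent_sub c b t ▸ expIntegral_nonneg fun _ => h0 _)

lemma abs_resolventDeriv_le (hM : ∀ s, |b s| ≤ M) (t : ℝ) : |resolventDeriv c b t| ≤ M := by
  have hα := decayRate_pos c
  have hβ := growthRate_pos c
  have hpast : decayRate c * |expIntegral (decayRate c) fun s => b (t - s)| ≤ M :=
    (le_div_iff₀' hα).1 (abs_expIntegral_le hα fun _ => hM _)
  have hfuture : growthRate c * |expIntegral (growthRate c) fun s => b (t + s)| ≤ M :=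
    (le_div_iff₀' hβ).1 (abs_expIntegral_le hβ fun _ => hM _)
  have hM0 : 0 ≤ M := (abs_nonneg _).trans (hM 0)
  rw [resolventDeriv, abs_div, abs_of_pos (decayRate_add_growthRate_pos c),
    div_le_iff₀ (decayRate_add_growthRate_pos c)]
  refine (abs_sub _ _).trans ?_
  rw [abs_mul, abs_mul, abs_of_pos hα, abs_of_pos hβ]
  nlinarith [two_le_decayRate_add_growthRate c]

lemma lipschitzWith_resolvent (hb : Continuous b) (hM : ∀ s, |b s| ≤ M) :
    LipschitzWith M.toNNReal (resolvent c b) := by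
  refine lipschitzWith_of_nnnorm_deriv_le
    (fun t => (hasDerivAt_resolvent hb hM t).differentiableAt) fun t => ?_
  rw [(hasDerivAt_resolvent hb hM t).deriv, ← NNReal.coe_le_coe, coe_nnnorm]
  exact (abs_resolventDeriv_le hM t).trans (Real.le_coe_toNNReal M)

lemma monotone_resolvent (hb : Monotone b) (hM : ∀ s, |b s| ≤ M) : Monotone (resolvent c b) := by
  intro t t' htt'
  rw [← add_sub_cancel t t', resolvent_add_right]
  exact resolvent_mono hb.measurable (hb.measurable.comp (by fun_prop)) hM (fun _ => hM _)
    (fun s => hb (by linarith)) t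

lemma second_deriv_resolvent_le (hb : Continuous b) (hmono : Monotone b) (hM : ∀ s, |b s| ≤ M)
    (t : ℝ) :
    c * resolventDeriv c b t + resolvent c b t - b t ≤ growthRate c * resolventDeriv c b t := by
  have hd := ((hasDerivAt_resolvent (c := c) hb hM t).const_mul (growthRate c)).sub
    (hasDerivAt_resolventDeriv (c := c) hb hM t)
  have hm : Monotone fun t => growthRate c * resolvent c b t - resolventDeriv c b t := by
    simp only [growthRate_mul_resolvent_sub]
    exact fun t t' htt' => expIntegral_mono (decayRate_pos c) (hmono.measurable.comp (by fun_prop))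
      (hmono.measurable.comp (by fun_prop)) (fun _ => hM _) (fun _ => hM _)
      fun s => hmono (by linarith)
  exact sub_nonneg.1 (hd.deriv ▸ hm.deriv_nonneg)

lemma le_second_deriv_resolvent (hb : Continuous b) (hmono : Monotone b) (hM : ∀ s, |b s| ≤ M)
    (t : ℝ) :
    -decayRate c * resolventDeriv c b t ≤ c * resolventDeriv c b t + resolvent c b t - b t := by
  have hd := ((hasDerivAt_resolvent (c := c) hb hM t).const_mul (decayRate c)).add
    (hasDerivAt_resolventDeriv (c := c) hb hM t)
  have hm : Monotone fun t => decayRate c * resolvent c b t + resolventDeriv c b t := by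
    simp only [decayRate_mul_resolvent_add]
    exact fun t t' htt' => expIntegral_mono (growthRate_pos c) (hmono.measurable.comp (by fun_prop))
      (hmono.measurable.comp (by fun_prop)) (fun _ => hM _) (fun _ => hM _)
      fun s => hmono (by linarith)
  have : 0 ≤ decayRate c * resolventDeriv c b t +
      (c * resolventDeriv c b t + resolvent c b t - b t) := hd.deriv ▸ hm.deriv_nonneg
  linarith

end Resolvent

section ExponentialGrowth

variable {u u' : ℝ → ℝ} {ω t s : ℝ}

lemma le_mul_exp_of_deriv_le (hd : ∀ t, HasDerivAt u (u' t) t) (hle : ∀ t, u' t ≤ ω * u t)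
    (hs : 0 ≤ s) : u (t + s) ≤ u t * Real.exp (ω * s) := by
  have he : ∀ x, HasDerivAt (fun x => u x * Real.exp (-(ω * x)))
      (u' x * Real.exp (-(ω * x)) + u x * (Real.exp (-(ω * x)) * -(ω * 1))) x := fun x =>
    (hd x).mul ((hasDerivAt_id x).const_mul ω).neg.exp
  have hanti : Antitone fun x => u x * Real.exp (-(ω * x)) := by
    refine antitone_of_deriv_nonpos (fun x => (he x).differentiableAt) fun x => ?_
    rw [(he x).deriv]
    nlinarith [hle x, Real.exp_pos (-(ω * x))]
  have h := mul_le_mul_of_nonneg_right (hanti (le_add_of_nonneg_right hs : t ≤ t + s))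
    (Real.exp_pos (ω * (t + s))).le
  simp only [mul_assoc, ← Real.exp_add] at h
  ring_nf at h ⊢
  simpa only [Real.exp_zero, mul_one] using h

lemma mul_exp_le_of_le_deriv (hd : ∀ t, HasDerivAt u (u' t) t) (hle : ∀ t, ω * u t ≤ u' t)
    (hs : 0 ≤ s) : u t * Real.exp (ω * s) ≤ u (t + s) := by
  have := le_mul_exp_of_deriv_le (u := fun t => -u t) (ω := ω) (t := t) (fun t => (hd t).neg)
    (fun t => by linarith [hle t]) hs
  linarith

end ExponentialGrowth

/-- A monostable reaction term on `[0, κ]`, extended to the real line by constants so that it is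
globally monotone, bounded and `L`-Lipschitz. -/
structure Reaction (G : ℝ → ℝ) (κ : ℝ) (L : ℝ≥0) : Prop where
  kappa_pos : 0 < κ
  monotone : Monotone G
  lipschitz : LipschitzWith L G
  map_zero : G 0 = 0
  map_kappa : G κ = κ
  nonneg : ∀ u, 0 ≤ G u
  le : ∀ u, G u ≤ κ
  lt : ∀ u, 0 < u → u < κ → u < G u

/-- The operator whose fixed points are the bounded solutions of the profile equation
`φ''(t) - cφ'(t) - φ(t) + G(φ(t - ch)) = 0`. -/
noncomputable def frontOperator (G : ℝ → ℝ) (c h : ℝ) (φ : ℝ → ℝ) : ℝ → ℝ :=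
  resolvent c fun s => G (φ (s - c * h))

lemma frontOperator_add_right (G : ℝ → ℝ) (c h : ℝ) (φ : ℝ → ℝ) (t τ : ℝ) :
    frontOperator G c h φ (t + τ) = frontOperator G c h (fun s => φ (s + τ)) t := by
  simp only [frontOperator, resolvent_add_right, sub_add_eq_add_sub]

/-- The candidates for wave profiles: nondecreasing functions with values in `[0, κ]` obeying the
Lipschitz bound that `frontOperator` imposes on its values. -/
structure IsProfile (κ : ℝ) (φ : ℝ → ℝ) : Prop where
  monotone : Monotone φ
  mem_Icc : ∀ t, φ t ∈ Icc 0 κ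
  lipschitz : LipschitzWith κ.toNNReal φ

lemma isCompact_setOf_isProfile (κ : ℝ) : IsCompact {φ : C(ℝ, ℝ) | IsProfile κ φ} := by
  refine ArzelaAscoli.isCompact_of_equicontinuous _ ?_
    (LipschitzWith.uniformEquicontinuous _ _ fun φ => φ.2.lipschitz).equicontinuous
  have himage : ContinuousMap.toFun '' {φ : C(ℝ, ℝ) | IsProfile κ φ} =
      {φ | Monotone φ} ∩ univ.pi (fun _ => Icc 0 κ) ∩ {φ | LipschitzWith κ.toNNReal φ} := by
    ext φ
    constructor
    · rintro ⟨φ, hφ, rfl⟩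
      exact ⟨⟨hφ.monotone, fun t _ => hφ.mem_Icc t⟩, hφ.lipschitz⟩
    · rintro ⟨⟨hm, hI⟩, hL⟩
      exact ⟨⟨φ, hL.continuous⟩, ⟨hm, fun t => hI t trivial, hL⟩, rfl⟩
  rw [himage]
  exact ((isCompact_univ_pi fun _ => isCompact_Icc).inter_left isClosed_monotone).inter_right
    (isClosed_setOfPred_lipschitzWith _)

lemma exists_tendsto_subseq_of_isProfile {κ : ℝ} {φ : ℕ → ℝ → ℝ} (hφ : ∀ n, IsProfile κ (φ n)) :
    ∃ φ₀, IsProfile κ φ₀ ∧ ∃ θ : ℕ → ℕ, StrictMono θ ∧ ∀ (x : ℕ → ℝ) (x₀ : ℝ),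
      Tendsto x atTop (𝓝 x₀) → Tendsto (fun n => φ (θ n) (x n)) atTop (𝓝 (φ₀ x₀)) := by
  let f : ℕ → C(ℝ, ℝ) := fun n => ⟨φ n, (hφ n).lipschitz.continuous⟩
  obtain ⟨φ₀, hφ₀, θ, hθ, hlim⟩ :=
    (isCompact_setOf_isProfile κ).tendsto_subseq (x := f) fun n => hφ n
  exact ⟨φ₀, hφ₀, θ, hθ, fun x x₀ hx =>
    (ContinuousEval.continuous_eval.tendsto (φ₀, x₀)).comp (hlim.prodMk_nhds hx)⟩

lemma IsProfile.of_tendsto {κ : ℝ} {φ : ℕ → ℝ → ℝ} {φ₀ : ℝ → ℝ} (hφ : ∀ n, IsProfile κ (φ n))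
    (hlim : ∀ t, Tendsto (fun n => φ n t) atTop (𝓝 (φ₀ t))) : IsProfile κ φ₀ where
  monotone := fun x y hxy =>
    le_of_tendsto_of_tendsto' (hlim x) (hlim y) fun n => (hφ n).monotone hxy
  mem_Icc := fun t => isClosed_Icc.mem_of_tendsto (hlim t)
    (Eventually.of_forall fun n => (hφ n).mem_Icc t)
  lipschitz := (isClosed_setOfPred_lipschitzWith _).mem_of_tendsto (tendsto_pi_nhds.2 hlim)
    (Eventually.of_forall fun n => (hφ n).lipschitz)

lemma exists_eq_half_of_tendsto {κ : ℝ} (hκ : 0 < κ) {φ : ℝ → ℝ} (hφ : Continuous φ)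
    (hbot : Tendsto φ atBot (𝓝 0)) (htop : Tendsto φ atTop (𝓝 κ)) : ∃ τ, φ τ = κ / 2 := by
  obtain ⟨x, hx⟩ := (hbot.eventually_lt_const (half_pos hκ)).exists
  obtain ⟨y, hy⟩ := (htop.eventually_const_lt (half_lt_self hκ)).exists
  exact mem_range_of_exists_le_of_exists_ge hφ ⟨x, hx.le⟩ ⟨y, hy.le⟩

namespace Reaction

variable {G : ℝ → ℝ} {κ c h r : ℝ} {L : ℝ≥0} {φ ψ : ℝ → ℝ}

lemma continuous (hG : Reaction G κ L) : Continuous G := hG.lipschitz.continuous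

lemma abs_le (hG : Reaction G κ L) (u : ℝ) : |G u| ≤ κ :=
  (abs_of_nonneg (hG.nonneg u)).trans_le (hG.le u)

lemma map_add_le (hG : Reaction G κ L) (u : ℝ) {v : ℝ} (hv : 0 ≤ v) : G (u + v) ≤ G u + L * v := by
  have := hG.lipschitz.dist_le_mul (u + v) u
  rw [Real.dist_eq, Real.dist_eq, add_sub_cancel_left, abs_of_nonneg hv] at this
  linarith [le_abs_self (G (u + v) - G u)]

lemma map_le_mul (hG : Reaction G κ L) {u : ℝ} (hu : 0 ≤ u) : G u ≤ L * u := by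
  simpa only [zero_add, hG.map_zero] using hG.map_add_le 0 hu

lemma eq_zero_of_map_le (hG : Reaction G κ L) {u : ℝ} (h0 : 0 ≤ u) (h1 : u < κ) (h : G u ≤ u) :
    u = 0 :=
  h0.eq_or_lt.elim Eq.symm fun hu => absurd (hG.lt u hu h1) h.not_gt

lemma le_map (hG : Reaction G κ L) {u : ℝ} (hu : u ∈ Icc 0 κ) : u ≤ G u := by
  rcases hu.1.eq_or_lt with rfl | h0
  · exact hG.map_zero.ge
  rcases hu.2.eq_or_lt with rfl | h1
  exacts [hG.map_kappa.ge, (hG.lt u h0 h1).le]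

lemma eq_kappa_of_map_le (hG : Reaction G κ L) {u : ℝ} (h0 : 0 < u) (h1 : u ≤ κ) (h : G u ≤ u) :
    u = κ :=
  h1.eq_or_lt.elim id fun hu => absurd (hG.lt u h0 hu) h.not_gt

lemma measurable_delay (hG : Reaction G κ L) (hφ : Measurable φ) (d : ℝ) :
    Measurable fun s => G (φ (s - d)) :=
  hG.continuous.measurable.comp (hφ.comp (by fun_prop))

lemma frontOperator_mem_Icc (hG : Reaction G κ L) (hφ : Measurable φ) (t : ℝ) :
    frontOperator G c h φ t ∈ Icc 0 κ :=
  ⟨resolvent_nonneg (fun _ => hG.nonneg _) t,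
    resolvent_le (hG.measurable_delay hφ _) (fun _ => hG.abs_le _) t⟩

lemma frontOperator_mono (hG : Reaction G κ L) (hφ : Measurable φ) (hψ : Measurable ψ)
    (hle : ∀ s, φ s ≤ ψ s) (t : ℝ) : frontOperator G c h φ t ≤ frontOperator G c h ψ t :=
  resolvent_mono (hG.measurable_delay hφ _) (hG.measurable_delay hψ _) (fun _ => hG.abs_le _)
    (fun _ => hG.abs_le _) (fun _ => hG.monotone (hle _)) t

lemma isProfile_frontOperator (hG : Reaction G κ L) (hφ : Continuous φ) (hm : Monotone φ) :
    IsProfile κ (frontOperator G c h φ) where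
  monotone := monotone_resolvent (fun _ _ hxy => hG.monotone (hm (by linarith)))
    fun _ => hG.abs_le _
  mem_Icc := hG.frontOperator_mem_Icc hφ.measurable
  lipschitz := lipschitzWith_resolvent (hG.continuous.comp (hφ.comp (by fun_prop)))
    fun _ => hG.abs_le _

lemma tendsto_frontOperator (hG : Reaction G κ L) {ι : Type*} {l : Filter ι}
    [l.IsCountablyGenerated] {c h : ι → ℝ} {c₀ h₀ : ℝ} (hc : Tendsto c l (𝓝 c₀))
    {φ : ι → ℝ → ℝ} {φ₀ : ℝ → ℝ} (hφ : ∀ i, Measurable (φ i))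
    (hlim : ∀ s, Tendsto (fun i => φ i (s - c i * h i)) l (𝓝 (φ₀ (s - c₀ * h₀)))) (t : ℝ) :
    Tendsto (fun i => frontOperator G (c i) (h i) (φ i) t) l (𝓝 (frontOperator G c₀ h₀ φ₀ t)) :=
  tendsto_resolvent hc (fun i => hG.measurable_delay (hφ i) _) (fun _ _ => hG.abs_le _)
    (fun s => (hG.continuous.tendsto _).comp (hlim s)) t

lemma tendsto_frontOperator_atTop (hG : Reaction G κ L) (hφ : Measurable φ)
    (hr : Tendsto φ atTop (𝓝 r)) : Tendsto (frontOperator G c h φ) atTop (𝓝 (G r)) :=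
  tendsto_resolvent_atTop (hG.measurable_delay hφ _) (fun _ => hG.abs_le _)
    ((hG.continuous.tendsto r).comp (hr.comp (tendsto_atTop_add_const_right _ _ tendsto_id)))

lemma tendsto_frontOperator_atBot (hG : Reaction G κ L) (hφ : Measurable φ)
    (hr : Tendsto φ atBot (𝓝 r)) : Tendsto (frontOperator G c h φ) atBot (𝓝 (G r)) :=
  tendsto_resolvent_atBot (hG.measurable_delay hφ _) (fun _ => hG.abs_le _)
    ((hG.continuous.tendsto r).comp (hr.comp (tendsto_atBot_add_const_right _ _ tendsto_id)))

lemma tendsto_atBot_of_frontOperator_le (hG : Reaction G κ L) (hm : Monotone φ)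
    (hmem : ∀ t, φ t ∈ Icc 0 κ) (hle : ∀ t, frontOperator G c h φ t ≤ φ t) {t : ℝ}
    (ht : φ t < κ) : Tendsto φ atBot (𝓝 0) := by
  have hlim := tendsto_atBot_ciInf hm ⟨0, forall_mem_range.2 fun t => (hmem t).1⟩
  have hmap :=
    le_of_tendsto_of_tendsto' (hG.tendsto_frontOperator_atBot hm.measurable hlim) hlim hle
  rwa [hG.eq_zero_of_map_le (ge_of_tendsto' hlim fun t => (hmem t).1)
    ((hm.le_of_tendsto hlim t).trans_lt ht) hmap] at hlim

lemma tendsto_atTop_of_frontOperator_le (hG : Reaction G κ L) (hm : Monotone φ)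
    (hmem : ∀ t, φ t ∈ Icc 0 κ) (hle : ∀ t, frontOperator G c h φ t ≤ φ t) {t : ℝ}
    (ht : 0 < φ t) : Tendsto φ atTop (𝓝 κ) := by
  have hlim := tendsto_atTop_ciSup hm ⟨κ, forall_mem_range.2 fun t => (hmem t).2⟩
  have hmap :=
    le_of_tendsto_of_tendsto' (hG.tendsto_frontOperator_atTop hm.measurable hlim) hlim hle
  rwa [hG.eq_kappa_of_map_le (ht.trans_le (hm.ge_of_tendsto hlim t))
    (le_of_tendsto' hlim fun t => (hmem t).2) hmap] at hlim

end Reaction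

/-- A nondecreasing wave profile of speed `c` connecting `0` with `κ`, the profile equation being
encoded by the fixed point property. -/
structure MonotoneFront (G : ℝ → ℝ) (κ c h : ℝ) (φ : ℝ → ℝ) : Prop where
  continuous : Continuous φ
  monotone : Monotone φ
  mem_Icc : ∀ t, φ t ∈ Icc 0 κ
  fixed : frontOperator G c h φ = φ
  tendsto_atBot : Tendsto φ atBot (𝓝 0)
  tendsto_atTop : Tendsto φ atTop (𝓝 κ)

namespace Reaction

variable {G : ℝ → ℝ} {κ : ℝ} {L : ℝ≥0}

lemma exists_monotoneFront_of_approx (hG : Reaction G κ L) {c h : ℕ → ℝ} {c₀ h₀ : ℝ}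
    (hc : Tendsto c atTop (𝓝 c₀)) (hh : Tendsto h atTop (𝓝 h₀)) {φ : ℕ → ℝ → ℝ}
    (hφ : ∀ n, IsProfile κ (φ n)) (hmid : ∀ n, φ n 0 = κ / 2)
    (happrox : ∀ t, Tendsto (fun n => φ n t - frontOperator G (c n) (h n) (φ n) t) atTop (𝓝 0)) :
    ∃ φ₀, MonotoneFront G κ c₀ h₀ φ₀ := by
  obtain ⟨φ₀, hφ₀, θ, hθ, hlim⟩ := exists_tendsto_subseq_of_isProfile hφ
  replace hθ := hθ.tendsto_atTop
  have hpoint : ∀ t, Tendsto (fun n => φ (θ n) t) atTop (𝓝 (φ₀ t)) :=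
    fun t => hlim _ t tendsto_const_nhds
  have hmid₀ : φ₀ 0 = κ / 2 :=
    tendsto_nhds_unique (hpoint 0) (by simp only [hmid, tendsto_const_nhds])
  have hfixed : ∀ t, frontOperator G c₀ h₀ φ₀ t = φ₀ t := fun t => by
    have hop := hG.tendsto_frontOperator (h := fun n => h (θ n)) (h₀ := h₀) (hc.comp hθ)
      (fun n => (hφ (θ n)).monotone.measurable)
      (fun s => hlim _ _ (tendsto_const_nhds.sub ((hc.comp hθ).mul (hh.comp hθ)))) t
    refine tendsto_nhds_unique hop ?_
    simpa only [Function.comp_def, sub_sub_cancel, sub_zero]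
      using (hpoint t).sub ((happrox t).comp hθ)
  have hκ := hG.kappa_pos
  exact ⟨φ₀, hφ₀.lipschitz.continuous, hφ₀.monotone, hφ₀.mem_Icc, funext hfixed,
    hG.tendsto_atBot_of_frontOperator_le hφ₀.monotone hφ₀.mem_Icc (fun t => (hfixed t).le)
      (t := 0) (by linarith),
    hG.tendsto_atTop_of_frontOperator_le hφ₀.monotone hφ₀.mem_Icc (fun t => (hfixed t).le)
      (t := 0) (by linarith)⟩

end Reaction

namespace MonotoneFront

variable {G : ℝ → ℝ} {κ c h : ℝ} {L : ℝ≥0} {φ : ℝ → ℝ}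

lemma isProfile (hG : Reaction G κ L) (hφ : MonotoneFront G κ c h φ) : IsProfile κ φ :=
  hφ.fixed ▸ hG.isProfile_frontOperator hφ.continuous hφ.monotone

lemma continuous_delay (hG : Reaction G κ L) (hφ : MonotoneFront G κ c h φ) :
    Continuous fun s => G (φ (s - c * h)) :=
  hG.continuous.comp (hφ.continuous.comp (by fun_prop))

lemma monotone_delay (hG : Reaction G κ L) (hφ : MonotoneFront G κ c h φ) :
    Monotone fun s => G (φ (s - c * h)) :=
  fun _ _ hst => hG.monotone (hφ.monotone (by linarith))

lemma resolvent_delay (hφ : MonotoneFront G κ c h φ) :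
    resolvent c (fun s => G (φ (s - c * h))) = φ :=
  hφ.fixed

lemma deriv_eq (hG : Reaction G κ L) (hφ : MonotoneFront G κ c h φ) :
    deriv φ = resolventDeriv c fun s => G (φ (s - c * h)) := by
  ext t
  nth_rw 1 [← hφ.resolvent_delay]
  exact (hasDerivAt_resolvent (hφ.continuous_delay hG) (fun _ => hG.abs_le _) t).deriv

lemma hasDerivAt (hG : Reaction G κ L) (hφ : MonotoneFront G κ c h φ) (t : ℝ) :
    HasDerivAt φ (deriv φ t) t := by
  rw [hφ.deriv_eq hG]
  nth_rw 1 [← hφ.resolvent_delay]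
  exact hasDerivAt_resolvent (hφ.continuous_delay hG) (fun _ => hG.abs_le _) t

lemma hasDerivAt_deriv (hG : Reaction G κ L) (hφ : MonotoneFront G κ c h φ) (t : ℝ) :
    HasDerivAt (deriv φ) (c * deriv φ t + φ t - G (φ (t - c * h))) t := by
  have := hasDerivAt_resolventDeriv (c := c) (hφ.continuous_delay hG) (fun _ => hG.abs_le _) t
  rwa [hφ.resolvent_delay, ← hφ.deriv_eq hG] at this

lemma deriv_nonneg (hφ : MonotoneFront G κ c h φ) (t : ℝ) : 0 ≤ deriv φ t :=
  hφ.monotone.deriv_nonneg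

lemma deriv_le (hG : Reaction G κ L) (hφ : MonotoneFront G κ c h φ) (t : ℝ) :
    deriv φ t ≤ growthRate c * φ t := by
  have := resolventDeriv_le (c := c) (b := fun s => G (φ (s - c * h))) (fun _ => hG.nonneg _) t
  rwa [hφ.resolvent_delay, ← hφ.deriv_eq hG] at this

lemma deriv_le_kappa (hG : Reaction G κ L) (hφ : MonotoneFront G κ c h φ) (t : ℝ) :
    deriv φ t ≤ κ := by
  rw [hφ.deriv_eq hG]
  exact (le_abs_self _).trans (abs_resolventDeriv_le (fun _ => hG.abs_le _) t)

lemma second_deriv_le (hG : Reaction G κ L) (hφ : MonotoneFront G κ c h φ) (t : ℝ) :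
    c * deriv φ t + φ t - G (φ (t - c * h)) ≤ growthRate c * deriv φ t := by
  have := second_deriv_resolvent_le (c := c) (hφ.continuous_delay hG) (hφ.monotone_delay hG)
    (fun _ => hG.abs_le _) t
  rwa [hφ.resolvent_delay, ← hφ.deriv_eq hG] at this

lemma le_second_deriv (hG : Reaction G κ L) (hφ : MonotoneFront G κ c h φ) (t : ℝ) :
    -decayRate c * deriv φ t ≤ c * deriv φ t + φ t - G (φ (t - c * h)) := by
  have := le_second_deriv_resolvent (c := c) (hφ.continuous_delay hG) (hφ.monotone_delay hG)
    (fun _ => hG.abs_le _) t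
  rwa [hφ.resolvent_delay, ← hφ.deriv_eq hG] at this

lemma le_mul_exp (hG : Reaction G κ L) (hφ : MonotoneFront G κ c h φ) (t : ℝ) {s : ℝ}
    (hs : 0 ≤ s) : φ (t + s) ≤ φ t * Real.exp (growthRate c * s) :=
  le_mul_exp_of_deriv_le (hφ.hasDerivAt hG) (hφ.deriv_le hG) hs

lemma deriv_le_mul_exp (hG : Reaction G κ L) (hφ : MonotoneFront G κ c h φ) (t : ℝ) {s : ℝ}
    (hs : 0 ≤ s) : deriv φ (t + s) ≤ deriv φ t * Real.exp (growthRate c * s) :=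
  le_mul_exp_of_deriv_le (hφ.hasDerivAt_deriv hG) (hφ.second_deriv_le hG) hs

lemma mul_exp_le_deriv (hG : Reaction G κ L) (hφ : MonotoneFront G κ c h φ) (t : ℝ) {s : ℝ}
    (hs : 0 ≤ s) : deriv φ t * Real.exp (-decayRate c * s) ≤ deriv φ (t + s) :=
  mul_exp_le_of_le_deriv (hφ.hasDerivAt_deriv hG) (hφ.le_second_deriv hG) hs

lemma pos (hG : Reaction G κ L) (hφ : MonotoneFront G κ c h φ) (t : ℝ) : 0 < φ t := by
  refine (hφ.mem_Icc t).1.lt_of_ne fun h0 => ?_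
  have hzero : ∀ s, t ≤ s → φ s ≤ 0 := fun s hs => by
    have := hφ.le_mul_exp hG t (sub_nonneg.2 hs)
    rwa [← h0, zero_mul, add_sub_cancel] at this
  exact hG.kappa_pos.not_ge
    (le_of_tendsto hφ.tendsto_atTop ((eventually_ge_atTop t).mono hzero))

lemma deriv_pos (hG : Reaction G κ L) (hφ : MonotoneFront G κ c h φ) (t : ℝ) : 0 < deriv φ t := by
  refine (hφ.deriv_nonneg t).lt_of_ne fun h0 => ?_
  have hzero : ∀ s, deriv φ s = 0 := fun s => by
    refine le_antisymm ?_ (hφ.deriv_nonneg s)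
    rcases le_total t s with hts | hst
    · have := hφ.deriv_le_mul_exp hG t (sub_nonneg.2 hts)
      rwa [← h0, zero_mul, add_sub_cancel] at this
    · have := hφ.mul_exp_le_deriv hG s (sub_nonneg.2 hst)
      rw [add_sub_cancel, ← h0] at this
      exact nonpos_of_mul_nonpos_left this (Real.exp_pos _)
  have hconst : φ = fun _ => φ 0 := funext fun s =>
    is_const_of_deriv_eq_zero (fun s => (hφ.hasDerivAt hG s).differentiableAt) hzero s 0
  have hbot := hφ.tendsto_atBot
  have htop := hφ.tendsto_atTop
  rw [hconst, tendsto_const_nhds_iff] at hbot htop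
  exact hG.kappa_pos.ne (hbot.symm.trans htop)

lemma strictMono (hG : Reaction G κ L) (hφ : MonotoneFront G κ c h φ) : StrictMono φ :=
  strictMono_of_deriv_pos (hφ.deriv_pos hG)

lemma shift (hφ : MonotoneFront G κ c h φ) (τ : ℝ) :
    MonotoneFront G κ c h fun t => φ (t + τ) where
  continuous := hφ.continuous.comp (by fun_prop)
  monotone := fun _ _ hst => hφ.monotone (by linarith)
  mem_Icc := fun _ => hφ.mem_Icc _
  fixed := funext fun t => by rw [← frontOperator_add_right, hφ.fixed]
  tendsto_atBot := hφ.tendsto_atBot.comp (tendsto_atBot_add_const_right _ τ tendsto_id)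
  tendsto_atTop := hφ.tendsto_atTop.comp (tendsto_atTop_add_const_right _ τ tendsto_id)

end MonotoneFront

/-- `f` is twice differentiable at `t` and satisfies the differential inequality of supersolutions
of the profile equation there. -/
def IsClassicalSupersolutionAt (G : ℝ → ℝ) (c h : ℝ) (f : ℝ → ℝ) (t : ℝ) : Prop :=
  ∃ (f' : ℝ → ℝ) (f₂ : ℝ), (∀ᶠ s in 𝓝 t, HasDerivAt f (f' s) s) ∧ HasDerivAt f' f₂ t ∧
    f₂ - c * f' t - f t + G (f (t - c * h)) ≤ 0

/-- A supersolution of the profile equation. The differential inequality is required in the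
viscosity sense and only where `ψ < κ`: the function touching `ψ` from above also has to dominate
`ψ` at the delayed time. -/
structure IsSupersolution (G : ℝ → ℝ) (κ c h : ℝ) (ψ : ℝ → ℝ) : Prop where
  continuous : Continuous ψ
  nonneg : ∀ t, 0 ≤ ψ t
  eventually_gt : ∀ r < κ, ∀ᶠ t in atTop, r < ψ t
  exists_lt : ∃ t, ψ t < κ
  exists_touching : ∀ t, ψ t < κ → ∃ f : ℝ → ℝ, f t = ψ t ∧ (∀ᶠ s in 𝓝 t, ψ s ≤ f s) ∧
    ψ (t - c * h) ≤ f (t - c * h) ∧ IsClassicalSupersolutionAt G c h f t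

lemma deriv_eq_zero_and_second_deriv_nonpos {f f' : ℝ → ℝ} {f₂ t : ℝ}
    (hf : ∀ᶠ s in 𝓝 t, HasDerivAt f (f' s) s) (hf' : HasDerivAt f' f₂ t) (hmax : IsLocalMax f t) :
    f' t = 0 ∧ f₂ ≤ 0 := by
  have hzero : f' t = 0 := hmax.hasDerivAt_eq_zero hf.self_of_nhds
  refine ⟨hzero, not_lt.1 fun hpos => ?_⟩
  have hderiv : deriv f =ᶠ[𝓝 t] f' := hf.mono fun s hs => hs.deriv
  have hsecond : deriv (deriv f) t = f₂ := by rw [hderiv.deriv_eq, hf'.deriv]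
  have hmin : IsLocalMin f t := isLocalMin_of_deriv_deriv_pos (hsecond ▸ hpos)
    (hderiv.self_of_nhds.trans hzero) hf.self_of_nhds.continuousAt
  have hconst : f =ᶠ[𝓝 t] fun _ => f t := by
    filter_upwards [hmax, hmin] with s hle hge using le_antisymm hle hge
  rw [hconst.deriv.deriv_eq, deriv_const', deriv_const] at hsecond
  exact hpos.ne hsecond

section Existence

variable {G : ℝ → ℝ} {κ c h ε T : ℝ} {L : ℝ≥0} {a ψ : ℝ → ℝ}

lemma exists_forall_sub_le_of_tendsto {u : ℝ → ℝ} (hu : Continuous u) (hle : ∀ t, u t ≤ κ)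
    (hbot : Tendsto u atBot (𝓝 0)) (hψ : Continuous ψ) (hψ0 : ∀ t, 0 ≤ ψ t)
    (hψκ : ∀ r < κ, ∀ᶠ t in atTop, r < ψ t) {t : ℝ} (ht : ψ t < u t) :
    ∃ x, ∀ s, u s - ψ s ≤ u x - ψ x := by
  refine (hu.sub hψ).exists_forall_ge' t ?_
  rw [cocompact_eq_atBot_atTop, eventually_sup]
  constructor
  · filter_upwards [hbot.eventually_lt_const (sub_pos.2 ht)] with s hs
    simp only [Pi.sub_apply]
    linarith [hψ0 s]
  · filter_upwards [hψκ (κ - (u t - ψ t)) (by linarith)] with s hs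
    simp only [Pi.sub_apply]
    linarith [hle s]

lemma IsSupersolution.frontOperator_le (hψ : IsSupersolution G κ c h ψ) (hG : Reaction G κ L)
    (ha : Continuous a) (haψ : ∀ t, a t ≤ ψ t) (hbot : Tendsto a atBot (𝓝 0)) (t : ℝ) :
    frontOperator G c h a t ≤ ψ t := by
  by_contra! hcon
  have hb : Continuous fun s => G (a (s - c * h)) := hG.continuous.comp (ha.comp (by fun_prop))
  have hu : ∀ s, HasDerivAt (frontOperator G c h a)
      (resolventDeriv c (fun r => G (a (r - c * h))) s) s :=
    hasDerivAt_resolvent hb fun _ => hG.abs_le _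
  have hu' := hasDerivAt_resolventDeriv (c := c) hb fun _ => hG.abs_le _
  have hle : ∀ s, frontOperator G c h a s ≤ κ := fun s =>
    (hG.frontOperator_mem_Icc ha.measurable s).2
  have hlim := hG.tendsto_frontOperator_atBot (c := c) (h := h) ha.measurable hbot
  rw [hG.map_zero] at hlim
  obtain ⟨x, hx⟩ := exists_forall_sub_le_of_tendsto (u := frontOperator G c h a)
    (continuous_iff_continuousAt.2 fun s => (hu s).continuousAt) hle hlim hψ.continuous hψ.nonneg
    hψ.eventually_gt hcon
  obtain ⟨f, hfx, hψf, hdelay, f', f₂, hf, hf', hineq⟩ :=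
    hψ.exists_touching x (by linarith [hx t, hle x])
  have hmax : IsLocalMax (fun s => frontOperator G c h a s - f s) x := by
    filter_upwards [hψf] with s hs
    linarith [hx s]
  obtain ⟨hfirst, hsecond⟩ := deriv_eq_zero_and_second_deriv_nonpos
    (hf.mono fun s hs => (hu s).sub hs) ((hu' x).sub hf') hmax
  have hGle : G (a (x - c * h)) ≤ G (f (x - c * h)) := hG.monotone ((haψ _).trans hdelay)
  rw [sub_eq_zero.1 hfirst, ← frontOperator] at hsecond
  linarith [hx t]

/-- The continuous obstacle vanishing up to `T` and equal to `ε` from `T + 1` on. -/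
noncomputable def ramp (ε T t : ℝ) : ℝ := ε * max 0 (min 1 (t - T))

lemma ramp_mem_Icc (hε : 0 ≤ ε) (T t : ℝ) : ramp ε T t ∈ Icc 0 ε :=
  ⟨mul_nonneg hε (le_max_left _ _),
    mul_le_of_le_one_right hε (max_le zero_le_one (min_le_left _ _))⟩

lemma ramp_of_le (ε : ℝ) {T t : ℝ} (h : t ≤ T) : ramp ε T t = 0 := by
  rw [ramp, max_eq_left (min_le_of_right_le (by linarith)), mul_zero]

lemma ramp_of_ge (ε : ℝ) {T t : ℝ} (h : T + 1 ≤ t) : ramp ε T t = ε := by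
  rw [ramp, min_eq_left (by linarith), max_eq_right zero_le_one, mul_one]

lemma monotone_ramp (hε : 0 ≤ ε) (T : ℝ) : Monotone (ramp ε T) := fun x y hxy =>
  mul_le_mul_of_nonneg_left (max_le_max le_rfl (min_le_min le_rfl (by linarith))) hε

lemma lipschitzWith_ramp (ε T : ℝ) : LipschitzWith ‖ε‖₊ (ramp ε T) := by
  have hsub : LipschitzWith 1 fun t => t - T := by
    simpa only [add_zero, id] using LipschitzWith.id.sub (LipschitzWith.const T)
  have hmul := (lipschitzWith_smul ε).comp ((hsub.const_min 1).const_max 0)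
  rwa [mul_one] at hmul

/-- The monotone map whose fixed points solve the obstacle problem for `frontOperator` with
obstacle `ramp ε T`. -/
noncomputable def obstacleStep (G : ℝ → ℝ) (c h ε T : ℝ) (a : ℝ → ℝ) (t : ℝ) : ℝ :=
  max (ramp ε T t) (frontOperator G c h a t)

lemma isProfile_obstacleStep (hG : Reaction G κ L) (hε : ε ∈ Icc 0 κ) (ha : IsProfile κ a) :
    IsProfile κ (obstacleStep G c h ε T a) := by
  have hop := hG.isProfile_frontOperator (c := c) (h := h) ha.lipschitz.continuous ha.monotone
  have hεκ : ‖ε‖₊ ≤ κ.toNNReal := by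
    rw [← Real.toNNReal_eq_nnnorm_of_nonneg hε.1]
    exact Real.toNNReal_le_toNNReal hε.2
  refine ⟨(monotone_ramp hε.1 T).max hop.monotone, fun t => ⟨?_, ?_⟩, ?_⟩
  · exact (hop.mem_Icc t).1.trans (le_max_right _ _)
  · exact max_le ((ramp_mem_Icc hε.1 T t).2.trans hε.2) (hop.mem_Icc t).2
  · have hmax := ((lipschitzWith_ramp ε T).weaken hεκ).max hop.lipschitz
    rwa [max_self] at hmax

lemma tendsto_obstacleStep_atBot (hG : Reaction G κ L) (ha : Measurable a)
    (hbot : Tendsto a atBot (𝓝 0)) : Tendsto (obstacleStep G c h ε T a) atBot (𝓝 0) := by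
  have hramp : Tendsto (ramp ε T) atBot (𝓝 0) :=
    tendsto_const_nhds.congr' ((eventually_le_atBot T).mono fun t ht => (ramp_of_le ε ht).symm)
  have hmax := hramp.max (hG.tendsto_frontOperator_atBot (c := c) (h := h) ha hbot)
  rwa [hG.map_zero, max_self] at hmax

lemma obstacleStep_le (hG : Reaction G κ L) (hψ : IsSupersolution G κ c h ψ) (hε : 0 ≤ ε)
    (hψT : ∀ t, T ≤ t → ε ≤ ψ t) (ha : Continuous a) (haψ : ∀ t, a t ≤ ψ t)
    (hbot : Tendsto a atBot (𝓝 0)) (t : ℝ) : obstacleStep G c h ε T a t ≤ ψ t := by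
  refine max_le ?_ (hψ.frontOperator_le hG ha haψ hbot t)
  rcases le_total T t with ht | ht
  · exact (ramp_mem_Icc hε T t).2.trans (hψT t ht)
  · exact (ramp_of_le ε ht).trans_le (hψ.nonneg t)

lemma exists_obstacleStep_eq (hG : Reaction G κ L) (hψ : IsSupersolution G κ c h ψ)
    (hε : ε ∈ Icc 0 κ) (hψT : ∀ t, T ≤ t → ε ≤ ψ t) :
    ∃ a, IsProfile κ a ∧ (∀ t, a t ≤ ψ t) ∧ obstacleStep G c h ε T a = a := by
  let u : ℕ → ℝ → ℝ := fun n => (obstacleStep G c h ε T)^[n] fun _ => 0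
  have hsucc : ∀ n, u (n + 1) = obstacleStep G c h ε T (u n) := fun n =>
    Function.iterate_succ_apply' _ n _
  have hinv : ∀ n, IsProfile κ (u n) ∧ Tendsto (u n) atBot (𝓝 0) ∧ ∀ t, u n t ≤ ψ t := by
    intro n
    induction n with
    | zero =>
      exact ⟨⟨monotone_const, fun _ => left_mem_Icc.2 hG.kappa_pos.le,
        (LipschitzWith.const 0).weaken zero_le⟩, tendsto_const_nhds, hψ.nonneg⟩
    | succ n ih =>
      obtain ⟨hprof, hbot, hle⟩ := ih
      rw [hsucc]
      exact ⟨isProfile_obstacleStep hG hε hprof,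
        tendsto_obstacleStep_atBot hG hprof.monotone.measurable hbot,
        obstacleStep_le hG hψ hε.1 hψT hprof.lipschitz.continuous hle hbot⟩
  have hmeas : ∀ n, Measurable (u n) := fun n => (hinv n).1.monotone.measurable
  have hinc : ∀ n t, u n t ≤ u (n + 1) t := by
    intro n
    induction n with
    | zero => exact fun t => ((hinv 1).1.mem_Icc t).1
    | succ n ih =>
      intro t
      rw [hsucc (n + 1)]
      nth_rw 1 [hsucc n]
      exact max_le_max le_rfl (hG.frontOperator_mono (hmeas _) (hmeas _) ih t)
  have hlim : ∀ t, Tendsto (fun n => u n t) atTop (𝓝 (⨆ n, u n t)) := fun t =>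
    tendsto_atTop_ciSup (monotone_nat_of_le_succ fun n => hinc n t)
      ⟨κ, forall_mem_range.2 fun n => ((hinv n).1.mem_Icc t).2⟩
  refine ⟨fun t => ⨆ n, u n t, .of_tendsto (fun n => (hinv n).1) hlim,
    fun t => le_of_tendsto' (hlim t) fun n => (hinv n).2.2 t, funext fun t => ?_⟩
  refine tendsto_nhds_unique ?_ ((tendsto_add_atTop_iff_nat 1).2 (hlim t))
  simp only [hsucc]
  exact tendsto_const_nhds.max
    (hG.tendsto_frontOperator tendsto_const_nhds hmeas (fun _ => hlim _) t)

lemma exists_isProfile_almost_fixed (hG : Reaction G κ L) (hψ : IsSupersolution G κ c h ψ)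
    (hε0 : 0 < ε) (hεκ : ε < κ) :
    ∃ φ, IsProfile κ φ ∧ φ 0 = κ / 2 ∧ ∀ t, φ t - frontOperator G c h φ t ∈ Icc 0 ε := by
  obtain ⟨T, hT⟩ := eventually_atTop.1 (hψ.eventually_gt ε hεκ)
  obtain ⟨a, ha, haψ, hfix⟩ :=
    exists_obstacleStep_eq hG hψ ⟨hε0.le, hεκ.le⟩ fun t ht => (hT t ht).le
  have hfix : ∀ t, max (ramp ε T t) (frontOperator G c h a t) = a t := congrFun hfix
  have hle : ∀ t, frontOperator G c h a t ≤ a t := fun t => hfix t ▸ le_max_right _ _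
  obtain ⟨t₁, ht₁⟩ := hψ.exists_lt
  have hbot := hG.tendsto_atBot_of_frontOperator_le ha.monotone ha.mem_Icc hle
    ((haψ t₁).trans_lt ht₁)
  have hpos : 0 < a (T + 1) := by
    rw [← hfix, ramp_of_ge ε le_rfl]
    exact lt_max_of_lt_left hε0
  have htop := hG.tendsto_atTop_of_frontOperator_le ha.monotone ha.mem_Icc hle hpos
  obtain ⟨τ, hτ⟩ := exists_eq_half_of_tendsto hG.kappa_pos ha.lipschitz.continuous hbot htop
  have hshift : LipschitzWith κ.toNNReal fun t => a (t + τ) := by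
    simpa only [add_zero, mul_one, Function.comp_def, id] using
      ha.lipschitz.comp (LipschitzWith.id.add (LipschitzWith.const τ))
  refine ⟨fun t => a (t + τ), ⟨fun x y hxy => ha.monotone (by linarith), fun t => ha.mem_Icc _,
    hshift⟩, by simpa only [zero_add] using hτ, fun t => ?_⟩
  rw [← frontOperator_add_right]
  change a (t + τ) - frontOperator G c h a (t + τ) ∈ Icc 0 ε
  refine ⟨sub_nonneg.2 (hle _), ?_⟩
  rw [sub_le_iff_le_add]
  nth_rw 1 [← hfix]
  exact max_le
    ((ramp_mem_Icc hε0.le _ _).2.trans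
      (le_add_of_nonneg_right (hG.frontOperator_mem_Icc ha.monotone.measurable _).1))
    (le_add_of_nonneg_left hε0.le)

theorem exists_monotoneFront_of_isSupersolution (hG : Reaction G κ L)
    (hψ : IsSupersolution G κ c h ψ) : ∃ φ, MonotoneFront G κ c h φ := by
  obtain ⟨ε, -, hε, hεlim⟩ := exists_seq_strictAnti_tendsto' hG.kappa_pos
  choose φ hprof hmid happrox using fun n =>
    exists_isProfile_almost_fixed hG hψ (hε n).1 (hε n).2
  exact hG.exists_monotoneFront_of_approx (c := fun _ => c) (h := fun _ => h) tendsto_const_nhds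
    tendsto_const_nhds hprof hmid fun t =>
      squeeze_zero (fun n => (happrox n t).1) (fun n => (happrox n t).2) hεlim

lemma MonotoneFront.exists_of_speed_le {c' : ℝ} {φ : ℝ → ℝ} (hφ : MonotoneFront G κ c h φ)
    (hG : Reaction G κ L) (hh : 0 ≤ h) (hcc' : c ≤ c') : ∃ φ', MonotoneFront G κ c' h φ' := by
  refine exists_monotoneFront_of_isSupersolution hG
    ⟨hφ.continuous, fun t => (hφ.mem_Icc t).1, fun r hr => hφ.tendsto_atTop.eventually_const_lt hr,
    (hφ.tendsto_atBot.eventually_lt_const hG.kappa_pos).exists, fun t _ => ⟨φ, rfl,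
    Eventually.of_forall fun _ => le_rfl, le_rfl, deriv φ, _,
    Eventually.of_forall (hφ.hasDerivAt hG), hφ.hasDerivAt_deriv hG t, ?_⟩⟩
  have hdelay : G (φ (t - c' * h)) ≤ G (φ (t - c * h)) :=
    hG.monotone (hφ.monotone (sub_le_sub_left (mul_le_mul_of_nonneg_right hcc' hh) t))
  linarith [mul_le_mul_of_nonneg_right hcc' (hφ.deriv_nonneg t)]

lemma hasDerivAt_const_mul_exp (B l t : ℝ) :
    HasDerivAt (fun s => B * Real.exp (l * s)) (B * l * Real.exp (l * t)) t :=
  (((hasDerivAt_id' t).const_mul l).exp.const_mul B).congr_deriv (by ring)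

lemma isClassicalSupersolutionAt_mul_exp {B l p t : ℝ} (hB : 0 ≤ B) (hχ : charFun p h c l ≤ 0)
    (hp : G (B * Real.exp (l * (t - c * h))) ≤ p * (B * Real.exp (l * (t - c * h)))) :
    IsClassicalSupersolutionAt G c h (fun s => B * Real.exp (l * s)) t := by
  refine ⟨_, _, Eventually.of_forall (hasDerivAt_const_mul_exp B l),
    hasDerivAt_const_mul_exp (B * l) l t, ?_⟩
  have hdelay : Real.exp (l * (t - c * h)) = Real.exp (l * t) * Real.exp (-(l * c * h)) := by
    rw [← Real.exp_add]
    ring_nf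
  have hle : B * Real.exp (l * t) * charFun p h c l ≤ 0 :=
    mul_nonpos_of_nonneg_of_nonpos (by positivity) hχ
  rw [charFun] at hle
  simp only [hdelay] at hp ⊢
  linarith

lemma isSupersolution_mul_exp (hG : Reaction G κ L) (hLc : L ≤ c) (hh : 0 ≤ h) :
    IsSupersolution G κ c h fun s => κ * Real.exp (1 * s) := by
  have hκ := hG.kappa_pos
  have hc : 0 ≤ c := L.2.trans hLc
  refine ⟨by fun_prop, fun t => by positivity, fun r hr => ?_, ⟨-1, ?_⟩, fun t _ => ⟨_, rfl,
    Eventually.of_forall fun _ => le_rfl, le_rfl,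
    isClassicalSupersolutionAt_mul_exp (p := L) hκ.le ?_ ?_⟩⟩
  · filter_upwards [eventually_ge_atTop 0] with t ht
    exact hr.trans_le (le_mul_of_one_le_right hκ.le (Real.one_le_exp (by linarith)))
  · exact mul_lt_of_lt_one_right hκ (Real.exp_lt_one_iff.2 (by norm_num))
  · have hexp : L * Real.exp (-(1 * c * h)) ≤ L :=
      mul_le_of_le_one_right L.2 (Real.exp_le_one_iff.2 (by linarith [mul_nonneg hc hh]))
    rw [charFun]
    linarith
  · exact hG.map_le_mul (by positivity)

lemma exists_monotoneFront_of_tendsto (hG : Reaction G κ L) {c h : ℕ → ℝ} {c₀ h₀ : ℝ}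
    (hc : Tendsto c atTop (𝓝 c₀)) (hh : Tendsto h atTop (𝓝 h₀))
    (hφ : ∀ n, ∃ φ, MonotoneFront G κ (c n) (h n) φ) : ∃ φ, MonotoneFront G κ c₀ h₀ φ := by
  have hnormalized : ∀ n, ∃ φ, MonotoneFront G κ (c n) (h n) φ ∧ φ 0 = κ / 2 := fun n => by
    obtain ⟨φ, hφ⟩ := hφ n
    obtain ⟨τ, hτ⟩ := exists_eq_half_of_tendsto hG.kappa_pos hφ.continuous hφ.tendsto_atBot
      hφ.tendsto_atTop
    exact ⟨_, hφ.shift τ, by simpa only [zero_add] using hτ⟩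
  choose φ hfront hmid using hnormalized
  refine hG.exists_monotoneFront_of_approx hc hh (fun n => (hfront n).isProfile hG) hmid
    fun t => ?_
  simp only [(hfront _).fixed, sub_self, tendsto_const_nhds]

/-- The speeds of monotone fronts. -/
def frontSpeeds (G : ℝ → ℝ) (κ h : ℝ) : Set ℝ := {c | ∃ φ, MonotoneFront G κ c h φ}

lemma exists_isLeast_frontSpeeds (hG : Reaction G κ L) {c₁ : ℝ} (hh : 0 ≤ h)
    (hc₁ : c₁ ∉ frontSpeeds G κ h) : ∃ c, c₁ < c ∧ IsLeast (frontSpeeds G κ h) c := by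
  have hlower : ∀ c ∈ frontSpeeds G κ h, c₁ < c := fun c ⟨φ, hφ⟩ =>
    not_le.1 fun hle => hc₁ (hφ.exists_of_speed_le hG hh hle)
  have hne : (frontSpeeds G κ h).Nonempty :=
    ⟨L, exists_monotoneFront_of_isSupersolution hG (isSupersolution_mul_exp hG le_rfl hh)⟩
  have hbdd : BddBelow (frontSpeeds G κ h) := ⟨c₁, fun c hc => (hlower c hc).le⟩
  obtain ⟨u, -, hu, hmem⟩ := exists_seq_tendsto_sInf hne hbdd
  have hinf : sInf (frontSpeeds G κ h) ∈ frontSpeeds G κ h :=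
    exists_monotoneFront_of_tendsto (h := fun _ => h) hG hu tendsto_const_nhds hmem
  exact ⟨_, hlower _ hinf, hinf, fun c hc => csInf_le hbdd hc⟩

end Existence

section Stretch

variable {G : ℝ → ℝ} {κ c h : ℝ} {L : ℝ≥0} {φ : ℝ → ℝ}

/-- The time change `t ↦ t - e^{-m(t - T)} / m`, close to the identity after time `T` and rapidly
diverging from it before. -/
noncomputable def stretch (m T t : ℝ) : ℝ := t - Real.exp (-(m * (t - T))) / m

lemma stretch_le {m : ℝ} (hm : 0 < m) (T t : ℝ) : stretch m T t ≤ t :=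
  sub_le_self _ (by positivity)

lemma sub_one_le_stretch {m T t : ℝ} (hm : 1 ≤ m) (ht : T ≤ t) : t - 1 ≤ stretch m T t := by
  have hm0 : 0 < m := one_pos.trans_le hm
  refine sub_le_sub_left (div_le_one_of_le₀ (le_trans ?_ hm) hm0.le) t
  exact Real.exp_le_one_iff.2 (neg_nonpos.2 (mul_nonneg hm0.le (sub_nonneg.2 ht)))

lemma stretch_sub_le {m s : ℝ} (hm : 0 < m) (hs : 0 ≤ s) (T t : ℝ) :
    stretch m T (t - s) ≤ stretch m T t - s := by
  have hexp : Real.exp (-(m * (t - T))) ≤ Real.exp (-(m * (t - s - T))) :=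
    Real.exp_le_exp.2 (neg_le_neg (mul_le_mul_of_nonneg_left (by linarith) hm.le))
  rw [stretch, stretch]
  linarith [div_le_div_of_nonneg_right hexp hm.le]

lemma hasDerivAt_exp_neg_mul_sub (m T t : ℝ) :
    HasDerivAt (fun s => Real.exp (-(m * (s - T)))) (-m * Real.exp (-(m * (t - T)))) t :=
  (((hasDerivAt_id' t).sub_const T).const_mul m).neg.exp.congr_deriv (by
    simp only [Pi.neg_apply]
    ring)

lemma hasDerivAt_stretch {m : ℝ} (hm : 0 < m) (T t : ℝ) :
    HasDerivAt (stretch m T) (1 + Real.exp (-(m * (t - T)))) t :=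
  ((hasDerivAt_id' t).sub ((hasDerivAt_exp_neg_mul_sub m T t).div_const m)).congr_deriv (by
    field_simp
    ring)

/-- The profile `φ` in stretched time, plus an exponentially growing correction. For suitable
parameters it is a supersolution for speeds slightly below that of the front `φ`. -/
noncomputable def stretchedProfile (φ : ℝ → ℝ) (m T μ a t : ℝ) : ℝ :=
  φ (stretch m T t) + μ * Real.exp (a * t)

/-- The derivative of `stretchedProfile φ m T μ a`. -/
noncomputable def stretchedProfileDeriv (φ : ℝ → ℝ) (m T μ a t : ℝ) : ℝ :=
  deriv φ (stretch m T t) * (1 + Real.exp (-(m * (t - T)))) + μ * a * Real.exp (a * t)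

lemma mul_sub_exp_le {m T t t₂ a μ r σ ℓ : ℝ} (hm : 0 ≤ m) (ha : 0 ≤ a) (hμ : 0 ≤ μ)
    (ht : t ≤ t₂) (hr : 0 ≤ r) (hσ : r ≤ σ) (hℓ : ℓ ≤ Real.exp (-(m * (t₂ - T))) / 2)
    (hμr : L * (μ * Real.exp (a * t₂)) ≤ r * (Real.exp (-(m * (t₂ - T))) / 2)) :
    σ * (ℓ - Real.exp (-(m * (t - T)))) ≤ (1 - L) * (μ * Real.exp (a * t)) := by
  have hgain : Real.exp (-(m * (t₂ - T))) ≤ Real.exp (-(m * (t - T))) := by gcongr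
  have hcorrection : μ * Real.exp (a * t) ≤ μ * Real.exp (a * t₂) := by gcongr
  calc σ * (ℓ - Real.exp (-(m * (t - T))))
      ≤ σ * -(Real.exp (-(m * (t₂ - T))) / 2) :=
        mul_le_mul_of_nonneg_left (by linarith) (hr.trans hσ)
    _ ≤ r * -(Real.exp (-(m * (t₂ - T))) / 2) :=
        mul_le_mul_of_nonpos_right hσ (neg_nonpos.2 (by positivity))
    _ ≤ -(L * (μ * Real.exp (a * t))) := by
        linarith [mul_le_mul_of_nonneg_left hcorrection L.coe_nonneg]
    _ ≤ (1 - L) * (μ * Real.exp (a * t)) := by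
        linarith [show 0 ≤ μ * Real.exp (a * t) by positivity]

namespace MonotoneFront

lemma hasDerivAt_stretchedProfile (hG : Reaction G κ L) (hφ : MonotoneFront G κ c h φ) {m : ℝ}
    (hm : 0 < m) (T μ a t : ℝ) :
    HasDerivAt (stretchedProfile φ m T μ a) (stretchedProfileDeriv φ m T μ a t) t :=
  ((hφ.hasDerivAt hG _).comp t (hasDerivAt_stretch hm T t)).add (hasDerivAt_const_mul_exp μ a t)

lemma hasDerivAt_stretchedProfileDeriv (hG : Reaction G κ L) (hφ : MonotoneFront G κ c h φ)
    {m : ℝ} (hm : 0 < m) (T μ a t : ℝ) :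
    HasDerivAt (stretchedProfileDeriv φ m T μ a)
      ((c * deriv φ (stretch m T t) + φ (stretch m T t) - G (φ (stretch m T t - c * h))) *
          (1 + Real.exp (-(m * (t - T)))) ^ 2 -
        m * Real.exp (-(m * (t - T))) * deriv φ (stretch m T t) +
        μ * a * a * Real.exp (a * t)) t := by
  have hcomp := (hφ.hasDerivAt_deriv hG _).comp t (hasDerivAt_stretch hm T t)
  refine ((hcomp.mul ((hasDerivAt_exp_neg_mul_sub m T t).const_add 1)).add
    (hasDerivAt_const_mul_exp (μ * a) a t)).congr_deriv ?_
  simp only [Function.comp_apply]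
  ring

lemma continuous_stretchedProfile (hG : Reaction G κ L) (hφ : MonotoneFront G κ c h φ) {m : ℝ}
    (hm : 0 < m) (T μ a : ℝ) : Continuous (stretchedProfile φ m T μ a) :=
  continuous_iff_continuousAt.2 fun t =>
    (hφ.hasDerivAt_stretchedProfile hG hm T μ a t).continuousAt

lemma mul_exp_le_stretchedProfile {m μ : ℝ} (hφ : MonotoneFront G κ c h φ) (T a t : ℝ) :
    μ * Real.exp (a * t) ≤ stretchedProfile φ m T μ a t :=
  le_add_of_nonneg_left (hφ.mem_Icc _).1

lemma stretchedProfile_le {m : ℝ} (hφ : MonotoneFront G κ c h φ) (hm : 0 < m) (T μ a t : ℝ) :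
    stretchedProfile φ m T μ a t ≤ φ t + μ * Real.exp (a * t) :=
  add_le_add_left (hφ.monotone (stretch_le hm T t)) _

lemma deriv_le_exp_mul_deriv (hG : Reaction G κ L) (hφ : MonotoneFront G κ c h φ) {s t : ℝ}
    (hst : s ≤ t) : deriv φ s ≤ Real.exp (decayRate c * (t - s)) * deriv φ t := by
  have hle := hφ.mul_exp_le_deriv hG s (sub_nonneg.2 hst)
  rwa [add_sub_cancel, neg_mul, Real.exp_neg, ← div_eq_mul_inv, div_le_iff₀' (Real.exp_pos _)]
    at hle

lemma sub_le_of_speed_le (hG : Reaction G κ L) (hφ : MonotoneFront G κ c h φ) (hh : 0 ≤ h)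
    {c' : ℝ} (hc' : 0 ≤ c') (hcc' : c' ≤ c) (t : ℝ) :
    φ (t - c' * h) - φ (t - c * h) ≤
      (c - c') * (h * Real.exp (decayRate c * (c * h))) * deriv φ t := by
  have hle : t - c * h ≤ t - c' * h := sub_le_sub_left (mul_le_mul_of_nonneg_right hcc' hh) t
  have hbound : ∀ s ∈ interior (Icc (t - c * h) (t - c' * h)),
      deriv φ s ≤ Real.exp (decayRate c * (c * h)) * deriv φ t := fun s hs => by
    rw [interior_Icc] at hs
    refine (hφ.deriv_le_exp_mul_deriv hG (hs.2.le.trans (sub_le_self t (by positivity)))).trans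
      (mul_le_mul_of_nonneg_right (Real.exp_le_exp.2 ?_) (hφ.deriv_nonneg t))
    exact mul_le_mul_of_nonneg_left (by linarith [hs.1]) (decayRate_pos c).le
  refine ((convex_Icc _ _).image_sub_le_mul_sub_of_deriv_le hφ.continuous.continuousOn
    (fun s _ => (hφ.hasDerivAt hG s).differentiableAt.differentiableWithinAt) hbound
    _ (left_mem_Icc.2 hle) _ (right_mem_Icc.2 hle) hle).trans_eq ?_
  ring

/-- The cost, relative to the slope of the profile, of lowering the speed of a front by one unit in
the profile equation. -/
noncomputable def speedCost (L : ℝ≥0) (c h : ℝ) : ℝ :=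
  1 + L * (h * Real.exp (decayRate c * (c * h)))

lemma map_stretchedProfile_delay_le (hG : Reaction G κ L) (hφ : MonotoneFront G κ c h φ)
    (hh : 0 ≤ h) {c' m T μ a t Γ : ℝ} (hm : 0 < m) (hμ : 0 ≤ μ) (ha : 0 ≤ a) (hc' : 0 ≤ c')
    (hcc' : c' ≤ c)
    (hΓ : ∀ y v, φ (stretch m T t - c * h) ≤ y → 0 ≤ v → G (y + v) ≤ G y + Γ * v) :
    G (stretchedProfile φ m T μ a (t - c' * h)) ≤ G (φ (stretch m T t - c * h)) +
      (c - c') * (speedCost L c h - 1) * deriv φ (stretch m T t) +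
      Γ * (μ * Real.exp (a * t)) := by
  have hdelay : 0 ≤ c' * h := mul_nonneg hc' hh
  have hmono : φ (stretch m T t - c * h) ≤ φ (stretch m T t - c' * h) :=
    hφ.monotone (sub_le_sub_left (mul_le_mul_of_nonneg_right hcc' hh) _)
  have hstretched : stretchedProfile φ m T μ a (t - c' * h) ≤
      φ (stretch m T t - c' * h) + μ * Real.exp (a * t) :=
    add_le_add (hφ.monotone (stretch_sub_le hm hdelay T t))
      (mul_le_mul_of_nonneg_left (Real.exp_le_exp.2
        (mul_le_mul_of_nonneg_left (sub_le_self t hdelay) ha)) hμ)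
  have hlip := hG.map_add_le (φ (stretch m T t - c * h)) (sub_nonneg.2 hmono)
  rw [add_sub_cancel] at hlip
  calc G (stretchedProfile φ m T μ a (t - c' * h))
      ≤ G (φ (stretch m T t - c' * h)) + Γ * (μ * Real.exp (a * t)) :=
        (hG.monotone hstretched).trans (hΓ _ _ hmono (by positivity))
    _ ≤ G (φ (stretch m T t - c * h)) +
          L * ((c - c') * (h * Real.exp (decayRate c * (c * h))) * deriv φ (stretch m T t)) +
          Γ * (μ * Real.exp (a * t)) := by
        have := mul_le_mul_of_nonneg_left
          (hφ.sub_le_of_speed_le hG hh hc' hcc' (stretch m T t)) L.2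
        gcongr
        exact hlip.trans (add_le_add_right this _)
    _ = _ := by
        rw [speedCost]
        ring

lemma second_deriv_stretch_le (hG : Reaction G κ L) (hφ : MonotoneFront G κ c h φ) {Q : ℝ}
    (hQ0 : 0 ≤ Q) (hQ1 : Q ≤ 1) (t : ℝ) :
    (c * deriv φ t + φ t - G (φ (t - c * h))) * (1 + Q) ^ 2 -
        (3 * growthRate c + 1) * Q * deriv φ t ≤
      c * deriv φ t + φ t - G (φ (t - c * h)) - Q * deriv φ t := by
  have hslope : 0 ≤ growthRate c * deriv φ t :=
    mul_nonneg (growthRate_pos c).le (hφ.deriv_nonneg t)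
  have hfactor : (1 + Q) ^ 2 - 1 ≤ 3 * Q := by linarith [mul_le_mul_of_nonneg_left hQ1 hQ0]
  have hfactor0 : 0 ≤ (1 + Q) ^ 2 - 1 := by linarith [sq_nonneg Q]
  linarith [(mul_le_mul_of_nonneg_right (hφ.second_deriv_le hG t) hfactor0).trans
    (mul_le_mul_of_nonneg_left hfactor hslope)]

/-- The slope gain `-e^{-m(t - T)}` comes from the stretching of time, the loss `speedCost` from
lowering the speed; `Γ` is a Lipschitz constant for the influence of the correction. -/
lemma isClassicalSupersolutionAt_stretchedProfile (hG : Reaction G κ L)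
    (hφ : MonotoneFront G κ c h φ) (hh : 0 ≤ h) {c' m T μ a t Γ : ℝ}
    (hm : m = 3 * growthRate c + 1) (hμ : 0 ≤ μ) (ha : 0 ≤ a) (hac' : a ≤ c') (hcc' : c' ≤ c)
    (hT : T ≤ t)
    (hΓ : ∀ y v, φ (stretch m T t - c * h) ≤ y → 0 ≤ v → G (y + v) ≤ G y + Γ * v)
    (hle : deriv φ (stretch m T t) * ((c - c') * speedCost L c h - Real.exp (-(m * (t - T)))) ≤
      (1 - Γ) * (μ * Real.exp (a * t))) :
    IsClassicalSupersolutionAt G c' h (stretchedProfile φ m T μ a) t := by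
  have hm0 : 0 < m := by linarith [growthRate_pos c]
  have hc' : 0 ≤ c' := ha.trans hac'
  refine ⟨_, _, Eventually.of_forall (hφ.hasDerivAt_stretchedProfile hG hm0 T μ a),
    hφ.hasDerivAt_stretchedProfileDeriv hG hm0 T μ a t, ?_⟩
  have hdelay := hφ.map_stretchedProfile_delay_le hG hh hm0 hμ ha hc' hcc' hΓ
  have hsecond := hφ.second_deriv_stretch_le hG (Real.exp_pos (-(m * (t - T)))).le
    (Real.exp_le_one_iff.2 (neg_nonpos.2 (mul_nonneg hm0.le (sub_nonneg.2 hT)))) (stretch m T t)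
  rw [← hm] at hsecond
  have hstretching : 0 ≤ c' * (deriv φ (stretch m T t) * Real.exp (-(m * (t - T)))) :=
    mul_nonneg hc' (mul_nonneg (hφ.deriv_nonneg _) (Real.exp_pos _).le)
  have hcorrection : a * (a * (μ * Real.exp (a * t))) ≤ c' * (a * (μ * Real.exp (a * t))) :=
    mul_le_mul_of_nonneg_right hac' (by positivity)
  rw [stretchedProfileDeriv, stretchedProfile]
  linarith

lemma exists_pos_le_deriv (hG : Reaction G κ L) (hφ : MonotoneFront G κ c h φ) (s t : ℝ) :
    ∃ r > 0, ∀ x ∈ Icc s t, r ≤ deriv φ x := by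
  have hcont : Continuous (deriv φ) :=
    continuous_iff_continuousAt.2 fun x => (hφ.hasDerivAt_deriv hG x).continuousAt
  rcases (Icc s t).eq_empty_or_nonempty with hempty | hne
  · exact ⟨1, one_pos, by simp only [hempty, mem_empty_iff_false, false_implies, implies_true]⟩
  · obtain ⟨x, -, hx⟩ := isCompact_Icc.exists_isMinOn hne hcont.continuousOn
    exact ⟨_, hφ.deriv_pos hG x, hx⟩

/-- Before some time `t₂` the stretching of time pays for the lower speed; after `t₂` the
correction does, since `G` contracts near `κ`. -/
lemma eventually_isClassicalSupersolutionAt_stretchedProfile (hG : Reaction G κ L)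
    (hφ : MonotoneFront G κ c h φ) (hc : 0 < c) (hh : 0 ≤ h) {δ γ m : ℝ} (hδ : 0 < δ) (hγ : γ < 1)
    (hkappa : ∀ u v, κ - δ ≤ u → 0 ≤ v → G (u + v) ≤ G u + γ * v)
    (hm : m = 3 * growthRate c + 1) (T : ℝ) :
    ∀ᶠ μ in 𝓝[>] 0, ∀ᶠ c' in 𝓝[<] c, ∀ t, T ≤ t →
      IsClassicalSupersolutionAt G c' h (stretchedProfile φ m T μ (c / 2)) t := by
  have hm1 : 1 ≤ m := by linarith [growthRate_pos c]
  obtain ⟨s, hs⟩ := eventually_atTop.1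
    (hφ.tendsto_atTop.eventually_const_le (sub_lt_self κ hδ))
  set t₂ := s + 1 + c * h
  obtain ⟨r, hr, hslope⟩ := hφ.exists_pos_le_deriv hG (T - 1) t₂
  set Q := Real.exp (-(m * (t₂ - T)))
  have hQ0 : 0 < Q := Real.exp_pos _
  have hμsmall : ∀ᶠ μ in 𝓝[>] (0 : ℝ), L * (μ * Real.exp (c / 2 * t₂)) < r * (Q / 2) :=
    (Continuous.tendsto' (by fun_prop) 0 0 (by simp)).eventually_lt_const (by positivity)
      |>.filter_mono nhdsWithin_le_nhds
  filter_upwards [hμsmall, self_mem_nhdsWithin] with μ hμ (hμ0 : 0 < μ)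
  have hlim : Tendsto (fun c' => (c - c') * speedCost L c h) (𝓝[<] c) (𝓝 0) :=
    (Continuous.tendsto' (by fun_prop) c 0 (by simp)).mono_left nhdsWithin_le_nhds
  have hκlim : Tendsto (fun c' => κ * ((c - c') * speedCost L c h)) (𝓝[<] c) (𝓝 0) := by
    simpa only [mul_zero] using hlim.const_mul κ
  filter_upwards [self_mem_nhdsWithin, hlim.eventually_lt_const (half_pos hQ0),
    hκlim.eventually_lt_const (mul_pos (sub_pos.2 hγ) (show 0 < μ * Real.exp (c / 2 * t₂) by
      positivity)), nhdsWithin_le_nhds (eventually_gt_nhds (half_lt_self hc))]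
    with c' (hc'c : c' < c) hloss hκloss hc' t ht
  have hx := sub_one_le_stretch hm1 ht
  have hloss0 : 0 ≤ (c - c') * speedCost L c h :=
    mul_nonneg (sub_nonneg.2 hc'c.le) (by rw [speedCost]; positivity)
  rcases le_total t t₂ with htt₂ | htt₂
  · refine hφ.isClassicalSupersolutionAt_stretchedProfile hG hh hm hμ0.le (by positivity)
      hc'.le hc'c.le ht (fun y v _ hv => hG.map_add_le y hv) ?_
    have hr' : r ≤ deriv φ (stretch m T t) :=
      hslope _ ⟨by linarith, (stretch_le (by linarith) T t).trans htt₂⟩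
    exact mul_sub_exp_le (by linarith) (half_pos hc).le hμ0.le htt₂ hr.le hr' hloss.le hμ.le
  · refine hφ.isClassicalSupersolutionAt_stretchedProfile hG hh hm hμ0.le (by positivity)
      hc'.le hc'c.le ht (fun y v hy hv => hkappa y v ((hs _ ?_).trans hy) hv) ?_
    · linarith
    have hcorrection : μ * Real.exp (c / 2 * t₂) ≤ μ * Real.exp (c / 2 * t) := by gcongr
    calc deriv φ (stretch m T t) * ((c - c') * speedCost L c h - Real.exp (-(m * (t - T))))
        ≤ deriv φ (stretch m T t) * ((c - c') * speedCost L c h) :=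
          mul_le_mul_of_nonneg_left (sub_le_self _ (Real.exp_pos _).le) (hφ.deriv_nonneg _)
      _ ≤ κ * ((c - c') * speedCost L c h) :=
          mul_le_mul_of_nonneg_right (hφ.deriv_le_kappa hG _) hloss0
      _ ≤ (1 - γ) * (μ * Real.exp (c / 2 * t)) :=
          hκloss.le.trans (mul_le_mul_of_nonneg_left hcorrection (sub_pos.2 hγ).le)

end MonotoneFront

end Stretch

section Glue

variable {G : ℝ → ℝ} {κ c h t₀ t₁ w t : ℝ} {L : ℝ≥0} {φ f g : ℝ → ℝ}

/-- The function equal to `f` up to `t₁`, to `min f g` up to `t₀` and to `g` afterwards. -/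
noncomputable def glue (t₁ t₀ : ℝ) (f g : ℝ → ℝ) (t : ℝ) : ℝ :=
  if t ≤ t₁ then f t else if t ≤ t₀ then min (f t) (g t) else g t

lemma glue_le_left (ht : t ≤ t₀) : glue t₁ t₀ f g t ≤ f t := by
  rw [glue]
  split_ifs
  exacts [le_rfl, min_le_left _ _]

lemma glue_le_right (hfg : ∀ s ∈ Icc (t₁ - w) t₁, f s ≤ g s) (ht : t₁ - w ≤ t) :
    glue t₁ t₀ f g t ≤ g t := by
  rw [glue]
  split_ifs with h1
  exacts [hfg t ⟨ht, h1⟩, min_le_right _ _, le_rfl]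

lemma glue_of_gt (ht₁ : t₁ < t₀) (ht : t₀ < t) : glue t₁ t₀ f g t = g t := by
  rw [glue, if_neg (ht₁.trans ht).not_ge, if_neg ht.not_ge]

lemma glue_eq_or (ht₁ : t₁ < t₀) (hgf : g t₀ < f t₀) (t : ℝ) :
    (t < t₀ ∧ glue t₁ t₀ f g t = f t) ∨ (t₁ < t ∧ glue t₁ t₀ f g t = g t) := by
  rcases le_or_gt t t₁ with h₁ | h₁
  · exact .inl ⟨h₁.trans_lt ht₁, if_pos h₁⟩
  rcases le_or_gt t t₀ with h₀ | h₀
  · have hmin : glue t₁ t₀ f g t = min (f t) (g t) := by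
      rw [glue, if_neg h₁.not_ge, if_pos h₀]
    rcases le_or_gt (f t) (g t) with hle | hlt
    · exact .inl ⟨h₀.lt_of_ne fun heq => (heq ▸ hgf).not_ge hle, hmin.trans (min_eq_left hle)⟩
    · exact .inr ⟨h₁, hmin.trans (min_eq_right hlt.le)⟩
  · exact .inr ⟨h₁, glue_of_gt ht₁ h₀⟩

lemma continuous_glue (hf : Continuous f) (hg : Continuous g) (ht₁ : t₁ < t₀)
    (hfg : f t₁ ≤ g t₁) (hgf : g t₀ ≤ f t₀) : Continuous (glue t₁ t₀ f g) := by
  refine hf.if_le ((hf.min hg).if_le hg continuous_id continuous_const ?_) continuous_id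
    continuous_const ?_
  · rintro t rfl
    exact min_eq_right hgf
  · rintro t rfl
    rw [if_pos ht₁.le, min_eq_left hfg]

lemma isSupersolution_glue (hf : Continuous f) (hg : Continuous g) (hf0 : ∀ t, 0 ≤ f t)
    (hg0 : ∀ t, 0 ≤ g t) (hκ : 0 < κ) (hbot : Tendsto f atBot (𝓝 0))
    (htop : ∀ r < κ, ∀ᶠ t in atTop, r < g t) (ht₁ : t₁ < t₀) (hch : 0 ≤ c * h) (hw : c * h < w)
    (hfg : ∀ s ∈ Icc (t₁ - w) t₁, f s ≤ g s) (hgf : g t₀ < f t₀)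
    (hfsuper : ∀ t < t₀, IsClassicalSupersolutionAt G c h f t)
    (hgsuper : ∀ t > t₁, IsClassicalSupersolutionAt G c h g t) :
    IsSupersolution G κ c h (glue t₁ t₀ f g) where
  continuous := continuous_glue hf hg ht₁ (hfg t₁ (right_mem_Icc.2 (by linarith))) hgf.le
  nonneg := fun t => by
    rcases glue_eq_or ht₁ hgf t with ⟨-, heq⟩ | ⟨-, heq⟩ <;> rw [heq]
    exacts [hf0 t, hg0 t]
  eventually_gt := fun r hr => by
    filter_upwards [htop r hr, eventually_gt_atTop t₀] with t ht ht₀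
    rwa [glue_of_gt ht₁ ht₀]
  exists_lt := by
    obtain ⟨t, ht, ht₀⟩ := ((hbot.eventually_lt_const hκ).and (eventually_le_atBot t₀)).exists
    exact ⟨t, (glue_le_left ht₀).trans_lt ht⟩
  exists_touching := fun t _ => by
    rcases glue_eq_or ht₁ hgf t with ⟨ht, heq⟩ | ⟨ht, heq⟩
    · exact ⟨f, heq.symm, (eventually_le_nhds ht).mono fun s hs => glue_le_left hs,
        glue_le_left (by linarith), hfsuper t ht⟩
    · exact ⟨g, heq.symm,
        (eventually_ge_nhds ht).mono fun s hs => glue_le_right hfg (by linarith),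
        glue_le_right hfg (by linarith), hgsuper t ht⟩

namespace MonotoneFront

lemma mul_exp_le_apply_stretch (hG : Reaction G κ L) (hφ : MonotoneFront G κ c h φ)
    {B l m s : ℝ} (hB : 0 ≤ B) (hl : 0 ≤ l) (hm : 1 ≤ m) (hw : 0 ≤ w)
    (hlarge : B * Real.exp (growthRate c * (w + 1)) * Real.exp (l * t₁) ≤ φ t₁)
    (hs : s ∈ Icc (t₁ - w) t₁) : B * Real.exp (l * s) ≤ φ (stretch m (t₁ - w) s) := by
  have hgrowth := hφ.le_mul_exp hG (t₁ - (w + 1)) (s := w + 1) (by linarith)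
  rw [sub_add_cancel] at hgrowth
  have hend : B * Real.exp (l * t₁) ≤ φ (t₁ - (w + 1)) := by
    refine le_of_mul_le_mul_right ?_ (Real.exp_pos (growthRate c * (w + 1)))
    linarith
  calc B * Real.exp (l * s) ≤ B * Real.exp (l * t₁) := by gcongr; exact hs.2
    _ ≤ φ (t₁ - (w + 1)) := hend
    _ ≤ φ (stretch m (t₁ - w) s) :=
        hφ.monotone (by linarith [sub_one_le_stretch hm hs.1, hs.1])

lemma isSupersolution_glue_stretchedProfile (hG : Reaction G κ L) (hφ : MonotoneFront G κ c h φ)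
    {B a l m μ c' : ℝ} (hB : 0 ≤ B) (hl : 0 < l) (hm : 1 ≤ m) (hμ : 0 < μ) (ha : 0 < a)
    (ht₁ : t₁ < t₀) (hch : 0 ≤ c' * h) (hw : c' * h < w)
    (hlarge : B * Real.exp (growthRate c * (w + 1)) * Real.exp (l * t₁) ≤ φ t₁)
    (hcross : φ t₀ + μ * Real.exp (a * t₀) < B * Real.exp (l * t₀))
    (hexp : ∀ t < t₀, IsClassicalSupersolutionAt G c' h (fun s => B * Real.exp (l * s)) t)
    (hstretched :
      ∀ t > t₁, IsClassicalSupersolutionAt G c' h (stretchedProfile φ m (t₁ - w) μ a) t) :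
    IsSupersolution G κ c' h
      (glue t₁ t₀ (fun s => B * Real.exp (l * s)) (stretchedProfile φ m (t₁ - w) μ a)) := by
  have hm0 : 0 < m := by linarith
  have hbot : Tendsto (fun s => B * Real.exp (l * s)) atBot (𝓝 0) := by
    simpa only [mul_zero, Function.comp_def, id] using
      (Real.tendsto_exp_atBot.comp (tendsto_id.const_mul_atBot hl)).const_mul B
  have htop : Tendsto (fun s => μ * Real.exp (a * s)) atTop atTop :=
    (Real.tendsto_exp_atTop.comp (tendsto_id.const_mul_atTop ha)).const_mul_atTop hμ
  have hexp_le (s : ℝ) := hφ.mul_exp_le_stretchedProfile (m := m) (μ := μ) (t₁ - w) a s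
  refine isSupersolution_glue (by fun_prop) (hφ.continuous_stretchedProfile hG hm0 _ _ _)
    (fun s => by positivity) (fun s => le_trans (by positivity) (hexp_le s)) hG.kappa_pos hbot
    (fun r _ => (htop.eventually_gt_atTop r).mono fun s hs => hs.trans_le (hexp_le s))
    ht₁ hch hw (fun s hs => ?_) ((hφ.stretchedProfile_le hm0 _ _ _ _).trans_lt hcross)
    hexp hstretched
  exact (hφ.mul_exp_le_apply_stretch hG hB hl.le hm (by linarith) hlarge hs).trans
    (le_add_of_nonneg_right (by positivity))

/-- The supersolution for smaller speeds is `B e^{lt}` far to the left and a stretched profile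
afterwards; the two cross because the front decays more slowly than `e^{lt}`. -/
theorem exists_speed_lt (hG : Reaction G κ L) (hφ : MonotoneFront G κ c h φ) (hc : 0 < c)
    (hh : 0 ≤ h) {p l δ δ' γ : ℝ} (hl : 0 < l) (hχ : charFun p h c l < 0) (hδ : 0 < δ)
    (hzero : ∀ u, 0 ≤ u → u ≤ δ → G u ≤ p * u) (hδ' : 0 < δ') (hγ : γ < 1)
    (hkappa : ∀ u v, κ - δ' ≤ u → 0 ≤ v → G (u + v) ≤ G u + γ * v)
    (hslow : ∀ X, ∃ᶠ t in atBot, X * Real.exp (l * t) < φ t) :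
    ∃ c' < c, ∃ φ', MonotoneFront G κ c' h φ' := by
  set w := c * h + 1
  obtain ⟨m, hm⟩ : ∃ m, m = 3 * growthRate c + 1 := ⟨_, rfl⟩
  have hm1 : 1 ≤ m := by linarith [growthRate_pos c]
  obtain ⟨t₀, ht₀⟩ := (hφ.tendsto_atBot.eventually_lt_const (half_pos hδ)).exists
  have hφt₀ := hφ.pos hG t₀
  obtain ⟨B, hB, hBt₀⟩ : ∃ B, 0 < B ∧ B * Real.exp (l * t₀) = 2 * φ t₀ :=
    ⟨2 * φ t₀ / Real.exp (l * t₀), by positivity, div_mul_cancel₀ _ (Real.exp_pos _).ne'⟩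
  obtain ⟨t₁, hlarge, ht₁⟩ := ((hslow (B * Real.exp (growthRate c * (w + 1)))).and_eventually
    (eventually_lt_atBot t₀)).exists
  have hμsmall : ∀ᶠ μ in 𝓝[>] (0 : ℝ), μ * Real.exp (c / 2 * t₀) < φ t₀ :=
    (Continuous.tendsto' (by fun_prop) 0 0 (by simp)).eventually_lt_const hφt₀
      |>.filter_mono nhdsWithin_le_nhds
  obtain ⟨μ, hsuper, hμ, hμ0 : 0 < μ⟩ :=
    ((hφ.eventually_isClassicalSupersolutionAt_stretchedProfile hG hc hh hδ' hγ hkappa hm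
      (t₁ - w)).and (hμsmall.and self_mem_nhdsWithin)).exists
  have hχcont : Continuous fun c' => charFun p h c' l := by
    unfold charFun
    fun_prop
  obtain ⟨c', hsuper, ⟨hχ', hc'⟩, hc'c : c' < c⟩ :=
    (hsuper.and (((hχcont.tendsto c).eventually_lt_const hχ |>.and (eventually_gt_nhds hc)
      |>.filter_mono nhdsWithin_le_nhds).and self_mem_nhdsWithin)).exists
  have hch : c' * h ≤ c * h := by gcongr
  refine ⟨c', hc'c, exists_monotoneFront_of_isSupersolution hG
    (hφ.isSupersolution_glue_stretchedProfile hG hB.le hl hm1 hμ0 (half_pos hc) ht₁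
      (by positivity) (by linarith) hlarge.le (by linarith)
      (fun t ht => isClassicalSupersolutionAt_mul_exp hB.le hχ'.le (hzero _ (by positivity) ?_))
      fun t ht => hsuper t (by linarith [mul_nonneg hc.le hh]))⟩
  calc B * Real.exp (l * (t - c' * h)) ≤ B * Real.exp (l * t₀) := by
        gcongr
        linarith [mul_nonneg hc'.le hh]
    _ ≤ δ := by linarith

end MonotoneFront

end Glue

section CharFun

variable {p h c z : ℝ}

lemma hasDerivAt_charFun (p h c z : ℝ) :
    HasDerivAt (charFun p h c) (2 * z - c - p * Real.exp (-(z * c * h)) * (c * h)) z := by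
  have hexponent : HasDerivAt (fun z : ℝ => -(z * c * h)) (-(1 * c * h)) z :=
    (((hasDerivAt_id z).mul_const c).mul_const h).neg
  refine (((((hasDerivAt_id z).pow 2).sub ((hasDerivAt_id z).const_mul c)).sub_const 1).add
    (hexponent.exp.const_mul p)).congr_deriv ?_
  simp only [id]
  ring

lemma strictConvexOn_charFun (hp : 0 ≤ p) : StrictConvexOn ℝ univ (charFun p h c) := by
  have hsq : StrictConvexOn ℝ univ fun z : ℝ => z ^ 2 :=
    Even.strictConvexOn_pow even_two two_ne_zero
  have hlin : ConvexOn ℝ univ fun z : ℝ => -c * z - 1 :=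
    ConvexOn.add_const ((LinearMap.mul ℝ ℝ (-c)).convexOn convex_univ) (-1)
  have hexp : ConvexOn ℝ univ fun z : ℝ => p * Real.exp (-(c * h) * z) :=
    (convexOn_exp.comp_linearMap (LinearMap.mul ℝ ℝ (-(c * h)))).smul hp
  have heq : charFun p h c = (fun z => z ^ 2) + (fun z => -c * z - 1) +
      fun z => p * Real.exp (-(c * h) * z) := by
    funext z
    simp only [charFun, Pi.add_apply]
    ring_nf
  exact heq ▸ (hsq.add_convexOn hlin).add_convexOn hexp

lemma continuous_charFun_uncurry (p h : ℝ) :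
    Continuous fun x : ℝ × ℝ => charFun p h x.1 x.2 := by
  unfold charFun
  fun_prop

lemma continuous_charFun (p h c : ℝ) : Continuous (charFun p h c) :=
  (continuous_charFun_uncurry p h).comp (Continuous.prodMk_right c)

lemma continuous_charFun_speed (p h z : ℝ) : Continuous fun c => charFun p h c z :=
  (continuous_charFun_uncurry p h).comp (Continuous.prodMk_left z)

lemma charFun_zero_right (p h c : ℝ) : charFun p h c 0 = p - 1 := by
  simp only [charFun, zero_mul, mul_zero, neg_zero, Real.exp_zero]
  ring

lemma charFun_zero_speed_pos (hp : 1 < p) (h z : ℝ) : 0 < charFun p h 0 z := by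
  simp only [charFun, zero_mul, mul_zero, neg_zero, Real.exp_zero]
  nlinarith [sq_nonneg z]

lemma charFun_pos_of_add_one_le (hp : 0 < p) (hc : 0 ≤ c) (hz : c + 1 ≤ z) :
    0 < charFun p h c z := by
  have hexp : 0 < p * Real.exp (-(z * c * h)) := by positivity
  have hquad : 1 * 1 ≤ z * (z - c) :=
    mul_le_mul (by linarith) (by linarith) one_pos.le (by linarith)
  rw [charFun]
  linarith

lemma charFun_lt_charFun {c' : ℝ} (hp : 0 ≤ p) (hh : 0 ≤ h) (hz : 0 < z) (hlt : c < c') :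
    charFun p h c' z < charFun p h c z := by
  have hexp : p * Real.exp (-(z * c' * h)) ≤ p * Real.exp (-(z * c * h)) := by gcongr
  have hlin := mul_lt_mul_of_pos_right hlt hz
  simp only [charFun]
  linarith

lemma charFun_neg_of_mem_Ioo {l₁ l₂ : ℝ} (hp : 0 ≤ p) (h₁ : charFun p h c l₁ = 0)
    (h₂ : charFun p h c l₂ = 0) (hz : z ∈ Ioo l₁ l₂) : charFun p h c z < 0 := by
  have hlt := hz.1.trans hz.2
  simpa only [h₁, h₂, max_self] using
    (strictConvexOn_charFun (h := h) (c := c) hp).lt_on_openSegment (mem_univ l₁) (mem_univ l₂)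
      hlt.ne (openSegment_eq_Ioo hlt ▸ hz)

lemma ArePositiveRoots.charFun_left {l₁ l₂ : ℝ} (hl : ArePositiveRoots p h c l₁ l₂) :
    charFun p h c l₁ = 0 :=
  (hl.2.2 l₁ hl.1).2 (.inl rfl)

lemma ArePositiveRoots.charFun_right {l₁ l₂ : ℝ} (hl : ArePositiveRoots p h c l₁ l₂) :
    charFun p h c l₂ = 0 :=
  (hl.2.2 l₂ (hl.1.trans hl.2.1)).2 (.inr rfl)

lemma ArePositiveRoots.charFun_neg {l₁ l₂ : ℝ} (hp : 0 ≤ p) (hl : ArePositiveRoots p h c l₁ l₂)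
    (hz : z ∈ Ioo l₁ l₂) : charFun p h c z < 0 :=
  charFun_neg_of_mem_Ioo hp hl.charFun_left hl.charFun_right hz

lemma arePositiveRoots_of_charFun_eq_zero {l₁ l₂ : ℝ} (hp : 0 ≤ p) (hl₁ : 0 < l₁) (hl : l₁ < l₂)
    (h₁ : charFun p h c l₁ = 0) (h₂ : charFun p h c l₂ = 0) : ArePositiveRoots p h c l₁ l₂ := by
  refine ⟨hl₁, hl, fun z _ => ⟨fun hz => ?_, by rintro (rfl | rfl) <;> assumption⟩⟩
  rcases lt_trichotomy z l₁ with hlt | heq | hgt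
  · exact absurd h₁ (charFun_neg_of_mem_Ioo hp hz h₂ ⟨hlt, hl⟩).ne
  · exact .inl heq
  rcases lt_trichotomy z l₂ with hlt' | heq' | hgt'
  · exact absurd hz (charFun_neg_of_mem_Ioo hp h₁ h₂ ⟨hgt, hlt'⟩).ne
  · exact .inr heq'
  · exact absurd h₂ (charFun_neg_of_mem_Ioo hp h₁ hz ⟨hl, hgt'⟩).ne

lemma exists_arePositiveRoots (hp : 1 < p) (hc : 0 ≤ c) (hz : 0 < z)
    (hneg : charFun p h c z < 0) : ∃ l₁ l₂, ArePositiveRoots p h c l₁ l₂ := by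
  have hp0 : 0 < p := by linarith
  have hzero : 0 < charFun p h c 0 := by rw [charFun_zero_right]; linarith
  have hlarge : 0 < charFun p h c (c + 1 + z) := charFun_pos_of_add_one_le hp0 hc (by linarith)
  obtain ⟨l₁, ⟨hl₁, hl₁z⟩, h₁⟩ : ∃ l ∈ Ioo 0 z, charFun p h c l = 0 :=
    intermediate_value_Ioo' hz.le (continuous_charFun p h c).continuousOn ⟨hneg, hzero⟩
  obtain ⟨l₂, ⟨hzl₂, -⟩, h₂⟩ : ∃ l ∈ Ioo z (c + 1 + z), charFun p h c l = 0 :=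
    intermediate_value_Ioo (by linarith) (continuous_charFun p h c).continuousOn ⟨hneg, hlarge⟩
  exact ⟨l₁, l₂, arePositiveRoots_of_charFun_eq_zero hp0.le hl₁ (hl₁z.trans hzl₂) h₁ h₂⟩

lemma ArePositiveRoots.mul_exp_mul_lt {l₁ l₂ : ℝ} (hp : 0 ≤ p)
    (hl : ArePositiveRoots p h c l₁ l₂) :
    p * Real.exp (-(l₂ * c * h)) * (c * h) < 2 * l₂ - c := by
  obtain ⟨z, hz⟩ := exists_between hl.2.1
  have hslope := (strictConvexOn_charFun hp).convexOn.slope_le_of_hasDerivAt (mem_univ z)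
    (mem_univ l₂) hz.2 (hasDerivAt_charFun p h c l₂)
  have hslope_pos : 0 < slope (charFun p h c) z l₂ := by
    rw [slope_def_field, hl.charFun_right]
    exact div_pos (by linarith [hl.charFun_neg hp hz]) (sub_pos.2 hz.2)
  linarith

lemma exists_minimal_speed_charFun_nonpos (hp : 1 < p) (hc : 0 ≤ c) (hz : 0 ≤ z)
    (hle : charFun p h c z ≤ 0) :
    ∃ cs ∈ Ioc 0 c, (∃ y > 0, charFun p h cs y ≤ 0) ∧ ∀ y ≥ 0, 0 ≤ charFun p h cs y := by
  have hp0 : 0 < p := by linarith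
  have hbounded {c' y : ℝ} (hc' : c' ∈ Icc 0 c) (hy : charFun p h c' y ≤ 0) : y ≤ c + 1 := by
    by_contra! hlt
    exact hy.not_gt (charFun_pos_of_add_one_le hp0 hc'.1 (by linarith [hc'.2]))
  set K : Set (ℝ × ℝ) := (Icc 0 c ×ˢ Icc 0 (c + 1)) ∩ {x | charFun p h x.1 x.2 ≤ 0}
  have hK : IsCompact K := (isCompact_Icc.prod isCompact_Icc).inter_right
    (isClosed_le (continuous_charFun_uncurry p h) continuous_const)
  have hmem {c' y : ℝ} (hc' : c' ∈ Icc 0 c) (hy : 0 ≤ y) (hle : charFun p h c' y ≤ 0) :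
      (c', y) ∈ K := ⟨⟨hc', hy, hbounded hc' hle⟩, hle⟩
  obtain ⟨⟨cs, y⟩, ⟨⟨hcs, hy⟩, hle'⟩, hmin⟩ := hK.exists_isMinOn
    ⟨(c, z), hmem ⟨hc, le_rfl⟩ hz hle⟩ continuous_fst.continuousOn
  change charFun p h cs y ≤ 0 at hle'
  have hcs0 : 0 < cs := hcs.1.lt_of_ne fun heq : 0 = cs =>
    hle'.not_gt (heq ▸ charFun_zero_speed_pos hp h y)
  have hy0 : 0 < y := hy.1.lt_of_ne fun heq : 0 = y => by
    rw [← heq, charFun_zero_right] at hle'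
    linarith
  refine ⟨cs, ⟨hcs0, hcs.2⟩, ⟨y, hy0, hle'⟩, fun x hx => ?_⟩
  by_contra! hneg
  have hevent : ∀ᶠ c' in 𝓝[<] cs, charFun p h c' x < 0 ∧ 0 < c' :=
    (((continuous_charFun_speed p h x).tendsto cs).eventually_lt_const hneg
      |>.and (eventually_gt_nhds hcs0)).filter_mono nhdsWithin_le_nhds
  obtain ⟨c', ⟨hneg', hc'⟩, hlt : c' < cs⟩ := (hevent.and self_mem_nhdsWithin).exists
  exact hlt.not_ge (hmin (hmem ⟨hc'.le, hlt.le.trans hcs.2⟩ hx hneg'.le))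

lemma exists_isLinearSpeed_lt (hp : 1 < p) (hc : 0 ≤ c) (hz : 0 < z)
    (hneg : charFun p h c z < 0) : ∃ cs, IsLinearSpeed p h cs ∧ cs < c := by
  obtain ⟨cs, hcs, ⟨y, hy, hle⟩, hnonneg⟩ :=
    exists_minimal_speed_charFun_nonpos hp hc hz.le hneg.le
  have hzero : charFun p h cs y = 0 := hle.antisymm (hnonneg y hy.le)
  refine ⟨cs, ⟨y, hy, hzero, IsLocalMin.deriv_eq_zero ?_⟩, hcs.2.lt_of_ne ?_⟩
  · filter_upwards [eventually_gt_nhds hy] with x hx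
    exact hzero.le.trans (hnonneg x hx.le)
  · rintro rfl
    exact hneg.not_ge (hnonneg z hz.le)

lemma IsLinearSpeed.pos (hp : 0 ≤ p) (hh : 0 ≤ h) (hc : IsLinearSpeed p h c) : 0 < c := by
  obtain ⟨z, hz, -, hderiv⟩ := hc
  rw [(hasDerivAt_charFun p h c z).deriv] at hderiv
  by_contra! hc
  have : p * Real.exp (-(z * c * h)) * (c * h) ≤ 0 :=
    mul_nonpos_of_nonneg_of_nonpos (by positivity) (mul_nonpos_of_nonpos_of_nonneg hc hh)
  linarith

lemma IsLinearSpeed.exists_charFun_neg {cs : ℝ} (hp : 0 ≤ p) (hh : 0 ≤ h)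
    (hcs : IsLinearSpeed p h cs) (hlt : cs < c) : ∃ z, 0 < z ∧ charFun p h c z < 0 :=
  let ⟨z, hz, hzero, _⟩ := hcs
  ⟨z, hz, (charFun_lt_charFun hp hh hz hlt).trans_eq hzero⟩

end CharFun

section DelayInequality

lemma tendsto_const_mul_exp_atBot (A : ℝ) {a : ℝ} (ha : 0 < a) :
    Tendsto (fun t => A * Real.exp (a * t)) atBot (𝓝 0) := by
  simpa only [mul_zero, Function.comp_def, id] using
    (Real.tendsto_exp_atBot.comp (tendsto_id.const_mul_atBot ha)).const_mul A

lemma isBigO_exp_atBot_iff {f : ℝ → ℝ} {a : ℝ} :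
    f =O[atBot] (fun t => Real.exp (a * t)) ↔
      ∃ M ≥ 0, ∃ T, ∀ t ≤ T, |f t| ≤ M * Real.exp (a * t) := by
  refine ⟨fun hf => ?_, fun ⟨M, _, T, hT⟩ => .of_bound M ?_⟩
  · obtain ⟨M, hM, hf⟩ := hf.exists_nonneg
    obtain ⟨T, hT⟩ := eventually_atBot.1 hf.bound
    exact ⟨M, hM, T, fun t ht => by simpa only [Real.norm_eq_abs, Real.abs_exp] using hT t ht⟩
  · filter_upwards [eventually_le_atBot T] with t ht
    simpa only [Real.norm_eq_abs, Real.abs_exp] using hT t ht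

lemma isBigO_exp_exp_atBot {a b : ℝ} (hab : a ≤ b) :
    (fun t => Real.exp (b * t)) =O[atBot] fun t => Real.exp (a * t) :=
  isBigO_exp_atBot_iff.2 ⟨1, zero_le_one, 0, fun t ht => by
    rw [Real.abs_exp, one_mul]
    exact Real.exp_le_exp.2 (mul_le_mul_of_nonpos_right hab ht)⟩

lemma isBigO_mul_exp_atBot {f : ℝ → ℝ} {a : ℝ} (b : ℝ)
    (hf : f =O[atBot] fun t => Real.exp (a * t)) :
    (fun t => f t * Real.exp (b * t)) =O[atBot] fun t => Real.exp ((a + b) * t) := by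
  simpa only [← Real.exp_add, ← add_mul] using
    hf.mul (isBigO_refl (fun t => Real.exp (b * t)) atBot)

lemma eq_zero_of_isBigO_exp_atBot {A a b : ℝ} (hab : a < b)
    (hA : (fun t => A * Real.exp (a * t)) =O[atBot] fun t => Real.exp (b * t)) : A = 0 := by
  have hconst : (fun _ => A) =O[atBot] fun t => Real.exp ((b + -a) * t) := by
    refine (isBigO_mul_exp_atBot (-a) hA).congr_left fun t => ?_
    rw [mul_assoc, ← Real.exp_add, neg_mul, add_neg_cancel, Real.exp_zero, mul_one]
  refine tendsto_nhds_unique tendsto_const_nhds (hconst.trans_tendsto ?_)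
  simpa only [one_mul] using tendsto_const_mul_exp_atBot 1 (show 0 < b + -a by linarith)

lemma nonpos_of_deriv_add_mul_nonpos {y y' : ℝ → ℝ} {a T : ℝ} (hy : ∀ t, HasDerivAt y (y' t) t)
    (hle : ∀ t ≤ T, y' t + a * y t ≤ 0)
    (hlim : Tendsto (fun t => y t * Real.exp (a * t)) atBot (𝓝 0)) {t : ℝ} (ht : t ≤ T) :
    y t ≤ 0 := by
  have hd (t : ℝ) : HasDerivAt (fun t => y t * Real.exp (a * t))
      (y' t * Real.exp (a * t) + y t * (Real.exp (a * t) * (a * 1))) t :=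
    (hy t).mul ((hasDerivAt_id t).const_mul a).exp
  have hanti : AntitoneOn (fun t => y t * Real.exp (a * t)) (Iic T) := by
    refine antitoneOn_of_deriv_nonpos (convex_Iic T)
      (fun t _ => (hd t).continuousAt.continuousWithinAt)
      (fun t _ => (hd t).differentiableAt.differentiableWithinAt) fun t ht => ?_
    rw [interior_Iic] at ht
    rw [(hd t).deriv]
    linarith [mul_nonpos_of_nonpos_of_nonneg (hle t ht.le) (Real.exp_pos (a * t)).le]
  exact nonpos_of_mul_nonpos_left (ge_of_tendsto hlim
    ((eventually_le_atBot t).mono fun s hs => hanti (hs.trans ht) ht hs)) (Real.exp_pos _)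

lemma abs_le_of_abs_deriv_add_mul_le {w w' F F' : ℝ → ℝ} {a T : ℝ}
    (hw : ∀ t, HasDerivAt w (w' t) t) (hF : ∀ t, HasDerivAt F (F' t) t)
    (hle : ∀ t ≤ T, |w' t + a * w t| ≤ F' t + a * F t)
    (hwlim : Tendsto (fun t => w t * Real.exp (a * t)) atBot (𝓝 0))
    (hFlim : Tendsto (fun t => F t * Real.exp (a * t)) atBot (𝓝 0)) {t : ℝ} (ht : t ≤ T) :
    |w t| ≤ F t := by
  have hupper := nonpos_of_deriv_add_mul_nonpos (a := a) (fun t => (hw t).sub (hF t))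
    (fun t ht => by
      simp only [Pi.sub_apply]
      linarith [(abs_le.1 (hle t ht)).2])
    (by simpa only [sub_zero, Pi.sub_apply, sub_mul] using hwlim.sub hFlim) ht
  have hlower := nonpos_of_deriv_add_mul_nonpos (a := a) (fun t => ((hw t).add (hF t)).neg)
    (fun t ht => by
      simp only [Pi.neg_apply, Pi.add_apply]
      linarith [(abs_le.1 (hle t ht)).1])
    (by simpa only [add_zero, neg_zero, Pi.neg_apply, Pi.add_apply, neg_mul, add_mul] using
      (hwlim.add hFlim).neg) ht
  simp only [Pi.sub_apply, Pi.neg_apply, Pi.add_apply] at hupper hlower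
  exact abs_le.2 ⟨by linarith, by linarith⟩

lemma abs_integral_delay_le {w : ℝ → ℝ} {d ε σ D m T : ℝ} (hd : 0 ≤ d) (hσ : 0 ≤ σ) (hε : 0 ≤ ε)
    (hm : 0 ≤ m) (hD : 0 ≤ D)
    (hbound : ∀ t ≤ T, |w t| ≤ m * Real.exp (-ε * t) + D * Real.exp (σ * t)) {t : ℝ}
    (ht : t ≤ T) :
    |∫ s in (t - d)..t, w s|
      ≤ d * (Real.exp (ε * d) * (m * Real.exp (-ε * t)) + D * Real.exp (σ * t)) := by
  have hconst (s : ℝ) (hs : s ∈ uIoc (t - d) t) :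
      ‖w s‖ ≤ Real.exp (ε * d) * (m * Real.exp (-ε * t)) + D * Real.exp (σ * t) := by
    rw [uIoc_of_le (by linarith)] at hs
    calc ‖w s‖ ≤ m * Real.exp (-ε * s) + D * Real.exp (σ * s) := hbound s (hs.2.trans ht)
      _ ≤ m * Real.exp (ε * d + -ε * t) + D * Real.exp (σ * t) := by
          gcongr
          · linarith [mul_le_mul_of_nonneg_left hs.1.le hε]
          · exact hs.2
      _ = Real.exp (ε * d) * (m * Real.exp (-ε * t)) + D * Real.exp (σ * t) := by
          rw [Real.exp_add]
          ring
  have hint := intervalIntegral.norm_integral_le_of_norm_le_const hconst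
  rwa [sub_sub_cancel, abs_of_nonneg hd, mul_comm, Real.norm_eq_abs] at hint

lemma tendsto_exp_combination_mul_exp {a ε σ : ℝ} (hεa : ε < a) (hσa : 0 < σ + a) (m D : ℝ) :
    Tendsto (fun t => (m * Real.exp (-ε * t) + D * Real.exp (σ * t)) * Real.exp (a * t)) atBot
      (𝓝 0) := by
  have hlim := (tendsto_const_mul_exp_atBot m (sub_pos.2 hεa)).add
    (tendsto_const_mul_exp_atBot D hσa)
  rw [add_zero] at hlim
  refine hlim.congr fun t => ?_
  rw [sub_mul, add_mul, sub_eq_neg_add, Real.exp_add, Real.exp_add, neg_mul]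
  ring

lemma abs_le_of_delay_inequality_step {w w' : ℝ → ℝ} {a b d ε σ R D m T : ℝ}
    (hw : ∀ t, HasDerivAt w (w' t) t) (hb : 0 ≤ b) (hd : 0 ≤ d) (hσ : 0 ≤ σ) (hε : 0 ≤ ε)
    (hεa : ε < a) (hm : 0 ≤ m) (hD : 0 ≤ D) (hDR : b * d * D + R = (a + σ) * D)
    (heq : ∀ t ≤ T, |w' t + a * w t - b * ∫ s in (t - d)..t, w s| ≤ R * Real.exp (σ * t))
    (hbound : ∀ t ≤ T, |w t| ≤ m * Real.exp (-ε * t) + D * Real.exp (σ * t)) {t : ℝ}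
    (ht : t ≤ T) :
    |w t| ≤ b * d * Real.exp (ε * d) / (a - ε) * m * Real.exp (-ε * t)
      + D * Real.exp (σ * t) := by
  set ρ := b * d * Real.exp (ε * d) / (a - ε)
  have hρ : (a - ε) * ρ = b * d * Real.exp (ε * d) := mul_div_cancel₀ _ (sub_pos.2 hεa).ne'
  have hF (t : ℝ) : HasDerivAt (fun t => ρ * m * Real.exp (-ε * t) + D * Real.exp (σ * t))
      (ρ * m * -ε * Real.exp (-ε * t) + D * σ * Real.exp (σ * t)) t :=
    (hasDerivAt_const_mul_exp (ρ * m) (-ε) t).add (hasDerivAt_const_mul_exp D σ t)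
  have hwlim : Tendsto (fun t => w t * Real.exp (a * t)) atBot (𝓝 0) := by
    refine squeeze_zero_norm' ?_ (tendsto_exp_combination_mul_exp hεa (σ := σ) (by linarith) m D)
    filter_upwards [eventually_le_atBot T] with t ht
    rw [norm_mul, Real.norm_eq_abs, Real.norm_of_nonneg (Real.exp_pos _).le]
    exact mul_le_mul_of_nonneg_right (hbound t ht) (Real.exp_pos _).le
  refine abs_le_of_abs_deriv_add_mul_le hw hF (fun t ht => ?_) hwlim
    (tendsto_exp_combination_mul_exp hεa (by linarith) (ρ * m) D) ht
  have hint := mul_le_mul_of_nonneg_left (abs_integral_delay_le hd hσ hε hm hD hbound ht) hb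
  calc |w' t + a * w t|
      ≤ |w' t + a * w t - b * ∫ s in (t - d)..t, w s| + |b * ∫ s in (t - d)..t, w s| :=
        (congrArg abs (sub_add_cancel _ _).symm).trans_le (abs_add_le _ _)
    _ ≤ R * Real.exp (σ * t) + b * (d * (Real.exp (ε * d) * (m * Real.exp (-ε * t))
          + D * Real.exp (σ * t))) := by
        rw [abs_mul b, abs_of_nonneg hb]
        exact add_le_add (heq t ht) hint
    _ = _ := by
        linear_combination Real.exp (σ * t) * hDR - (m * Real.exp (-ε * t)) * hρ

/-- Bounding the integral by the current bound on `w` makes the slowly growing part of that bound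
contract by a factor `ρ < 1`. -/
lemma isBigO_exp_of_delay_equation {w w' : ℝ → ℝ} {a b d ε σ : ℝ}
    (hw : ∀ t, HasDerivAt w (w' t) t) (hb : 0 ≤ b) (hd : 0 ≤ d) (hσ : 0 ≤ σ) (hε : 0 < ε)
    (hcontract : b * d * Real.exp (ε * d) < a - ε)
    (heq : (fun t => w' t + a * w t - b * ∫ s in (t - d)..t, w s)
      =O[atBot] fun t => Real.exp (σ * t))
    (hbound : w =O[atBot] fun t => Real.exp (-ε * t)) :
    w =O[atBot] fun t => Real.exp (σ * t) := by
  obtain ⟨R, hR, T₁, hT₁⟩ := isBigO_exp_atBot_iff.1 heq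
  obtain ⟨m, hm, T₂, hT₂⟩ := isBigO_exp_atBot_iff.1 hbound
  have hεa : ε < a := by linarith [show 0 ≤ b * d * Real.exp (ε * d) by positivity]
  have hbd : b * d ≤ b * d * Real.exp (ε * d) :=
    le_mul_of_one_le_right (by positivity) (Real.one_le_exp (by positivity))
  have hpos : 0 < a + σ - b * d := by linarith
  obtain ⟨D, hD, hDR⟩ : ∃ D, 0 ≤ D ∧ b * d * D + R = (a + σ) * D :=
    ⟨R / (a + σ - b * d), by positivity, by field_simp; ring⟩
  set ρ := b * d * Real.exp (ε * d) / (a - ε)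
  have hρ0 : 0 ≤ ρ := div_nonneg (by positivity) (sub_pos.2 hεa).le
  have hρ1 : ρ < 1 := (div_lt_one (sub_pos.2 hεa)).2 hcontract
  have hiter (n : ℕ) :
      ∀ t ≤ min T₁ T₂, |w t| ≤ ρ ^ n * m * Real.exp (-ε * t) + D * Real.exp (σ * t) := by
    induction n with
    | zero =>
      intro t ht
      rw [pow_zero, one_mul]
      exact (hT₂ t (ht.trans (min_le_right _ _))).trans (le_add_of_nonneg_right (by positivity))
    | succ n ih =>
      intro t ht
      rw [pow_succ', mul_assoc ρ]
      exact abs_le_of_delay_inequality_step hw hb hd hσ hε.le hεa (by positivity) hD hDR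
        (fun t ht => hT₁ t (ht.trans (min_le_left _ _))) ih ht
  refine isBigO_exp_atBot_iff.2 ⟨D, hD, min T₁ T₂, fun t ht => ?_⟩
  have hlim := (((tendsto_pow_atTop_nhds_zero_of_lt_one hρ0 hρ1).mul_const m).mul_const
    (Real.exp (-ε * t))).add_const (D * Real.exp (σ * t))
  rw [zero_mul, zero_mul, zero_add] at hlim
  exact ge_of_tendsto' hlim fun n => hiter n t ht

lemma monotoneOn_add_mul_exp {J J' : ℝ → ℝ} {σ R T : ℝ} (hJ : ∀ t, HasDerivAt J (J' t) t)
    (hσ : 0 < σ) (hle : ∀ t ≤ T, |J' t| ≤ R * Real.exp (σ * t)) :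
    MonotoneOn (fun t => J t + R / σ * Real.exp (σ * t)) (Iic T) := by
  have hd (t : ℝ) : HasDerivAt (fun t => J t + R / σ * Real.exp (σ * t))
      (J' t + R / σ * σ * Real.exp (σ * t)) t :=
    (hJ t).add (hasDerivAt_const_mul_exp (R / σ) σ t)
  refine monotoneOn_of_deriv_nonneg (convex_Iic T)
    (fun t _ => (hd t).continuousAt.continuousWithinAt)
    (fun t _ => (hd t).differentiableAt.differentiableWithinAt) fun t ht => ?_
  rw [interior_Iic] at ht
  rw [(hd t).deriv, div_mul_cancel₀ _ hσ.ne']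
  linarith [(abs_le.1 (hle t ht.le)).1]

lemma exists_isBigO_sub_const {J J' : ℝ → ℝ} {σ : ℝ} (hJ : ∀ t, HasDerivAt J (J' t) t)
    (hσ : 0 < σ) (hJ' : J' =O[atBot] fun t => Real.exp (σ * t)) :
    ∃ C, (fun t => J t - C) =O[atBot] fun t => Real.exp (σ * t) := by
  obtain ⟨R, hR, T, hle⟩ := isBigO_exp_atBot_iff.1 hJ'
  have hupper := monotoneOn_add_mul_exp hJ hσ hle
  have hlower := monotoneOn_add_mul_exp (fun t => (hJ t).neg) hσ fun t ht => by
    rw [abs_neg]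
    exact hle t ht
  have hcross {t s : ℝ} (ht : t ≤ T) (hs : s ≤ T) :
      J t - R / σ * Real.exp (σ * t) ≤ J s + R / σ * Real.exp (σ * s) := by
    have hpos (r : ℝ) : 0 ≤ R / σ * Real.exp (σ * r) := by positivity
    rcases le_total s t with hst | hst
    · have := hlower hs ht hst
      simp only [Pi.neg_apply] at this
      linarith [hpos s]
    · have := hupper ht hs hst
      simp only at this
      linarith [hpos t]
  set S := (fun t => J t + R / σ * Real.exp (σ * t)) '' Iic T
  have hbdd : BddBelow S := ⟨_, forall_mem_image.2 fun s hs => hcross le_rfl hs⟩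
  refine ⟨sInf S, isBigO_exp_atBot_iff.2
    ⟨R / σ, by positivity, T, fun t ht => abs_le.2 ⟨?_, ?_⟩⟩⟩
  · have : sInf S ≤ J t + R / σ * Real.exp (σ * t) := csInf_le hbdd (mem_image_of_mem _ ht)
    linarith
  · have : J t - R / σ * Real.exp (σ * t) ≤ sInf S :=
      le_csInf ⟨_, mem_image_of_mem _ self_mem_Iic⟩ (forall_mem_image.2 fun s hs => hcross ht hs)
    linarith

end DelayInequality

section Asymptotics

/-- `G` is linear with slope `p` at `0`, up to an error of order `u ^ (1 + θ)` on `[0, δ]`. -/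
structure HolderLinearization (G : ℝ → ℝ) (p δ C θ : ℝ) : Prop where
  delta_pos : 0 < δ
  const_nonneg : 0 ≤ C
  theta_pos : 0 < θ
  abs_sub_le : ∀ u, 0 ≤ u → u ≤ δ → |G u - p * u| ≤ C * u ^ (1 + θ)

lemma hasDerivAt_integral_delay {v : ℝ → ℝ} (hv : Continuous v) (d t : ℝ) :
    HasDerivAt (fun t => ∫ s in (t - d)..t, v s) (v t - v (t - d)) t := by
  have hprimitive (x : ℝ) : HasDerivAt (fun x => ∫ s in (0 : ℝ)..x, v s) (v x) x :=
    intervalIntegral.integral_hasDerivAt_right (hv.intervalIntegrable _ _)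
      (hv.stronglyMeasurableAtFilter _ _) hv.continuousAt
  refine ((hprimitive t).sub ((hprimitive (t - d)).comp_sub_const t d)).congr_of_eventuallyEq
    (Eventually.of_forall fun x => ?_)
  exact (intervalIntegral.integral_interval_sub_left (hv.intervalIntegrable _ _)
    (hv.intervalIntegrable _ _)).symm

namespace MonotoneFront

variable {G : ℝ → ℝ} {κ c h p l δ C θ ε ρ : ℝ} {L : ℝ≥0} {φ : ℝ → ℝ}

lemma hasDerivAt_mul_exp_neg (hG : Reaction G κ L) (hφ : MonotoneFront G κ c h φ) (l t : ℝ) :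
    HasDerivAt (fun t => φ t * Real.exp (-l * t))
      ((deriv φ t - l * φ t) * Real.exp (-l * t)) t := by
  have hexp := hasDerivAt_const_mul_exp 1 (-l) t
  simp only [one_mul] at hexp
  exact ((hφ.hasDerivAt hG t).mul hexp).congr_deriv (by ring)

/-- Rescaled by the eigenfunction `e^{lt}`, the profile equation is in divergence form. -/
lemma hasDerivAt_divergence_form (hG : Reaction G κ L) (hφ : MonotoneFront G κ c h φ)
    (hχ : charFun p h c l = 0) (t : ℝ) :
    HasDerivAt (fun t => (deriv φ t - l * φ t) * Real.exp (-l * t)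
        + (2 * l - c) * (φ t * Real.exp (-l * t))
        - p * Real.exp (-(l * c * h)) * ∫ s in (t - c * h)..t, φ s * Real.exp (-l * s))
      ((p * φ (t - c * h) - G (φ (t - c * h))) * Real.exp (-l * t)) t := by
  have hexp := hasDerivAt_const_mul_exp 1 (-l) t
  simp only [one_mul] at hexp
  have hcont : Continuous fun t => φ t * Real.exp (-l * t) :=
    hφ.continuous.mul (by fun_prop)
  have hfirst := ((hφ.hasDerivAt_deriv hG t).sub ((hφ.hasDerivAt hG t).const_mul l)).mul hexp
  have hsecond := (hφ.hasDerivAt_mul_exp_neg hG l t).const_mul (2 * l - c)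
  have hdelay := (hasDerivAt_integral_delay hcont (c * h) t).const_mul
    (p * Real.exp (-(l * c * h)))
  refine ((hfirst.add hsecond).sub hdelay).congr_deriv ?_
  have hshift : Real.exp (-(l * c * h)) * Real.exp (-l * (t - c * h)) = Real.exp (-l * t) := by
    rw [← Real.exp_add]
    ring_nf
  rw [charFun] at hχ
  simp only [Pi.sub_apply]
  linear_combination (-φ t * Real.exp (-l * t)) * hχ + p * φ (t - c * h) * hshift

lemma isBigO_linearization_error (hlin : HolderLinearization G p δ C θ)
    (hφ : MonotoneFront G κ c h φ) (hch : 0 ≤ c * h)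
    (hρ : φ =O[atBot] fun t => Real.exp (ρ * t)) :
    (fun t => p * φ (t - c * h) - G (φ (t - c * h)))
      =O[atBot] fun t => Real.exp ((1 + θ) * ρ * t) := by
  have hθ : 0 ≤ 1 + θ := by linarith [hlin.theta_pos]
  have hpow : (fun t => φ t ^ (1 + θ)) =O[atBot] fun t => Real.exp ((1 + θ) * ρ * t) := by
    refine (hρ.rpow hθ (Eventually.of_forall fun t => (Real.exp_pos _).le)).congr_right fun t => ?_
    rw [← Real.exp_mul]
    ring_nf
  refine .trans (.of_bound C ?_) hpow
  filter_upwards [hφ.tendsto_atBot.eventually_lt_const hlin.delta_pos] with t ht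
  have hle : φ (t - c * h) ≤ φ t := hφ.monotone (sub_le_self t hch)
  have hnonneg := (hφ.mem_Icc (t - c * h)).1
  rw [norm_sub_rev, Real.norm_eq_abs,
    Real.norm_of_nonneg (Real.rpow_nonneg (hφ.mem_Icc t).1 _)]
  exact (hlin.abs_sub_le _ hnonneg (hle.trans ht.le)).trans
    (mul_le_mul_of_nonneg_left (Real.rpow_le_rpow hnonneg hle hθ) hlin.const_nonneg)

/-- Subtracting a multiple of the eigenfunction `e^{lt}` improves the decay rate by a factor
`1 + θ`. -/
lemma exists_isBigO_sub_mul_exp (hG : Reaction G κ L) (hlin : HolderLinearization G p δ C θ)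
    (hφ : MonotoneFront G κ c h φ) (hch : 0 ≤ c * h) (hp : 0 ≤ p) (hχ : charFun p h c l = 0)
    (hε : 0 < ε) (hcontract : p * Real.exp (-(l * c * h)) * (c * h) * Real.exp (ε * (c * h))
      < 2 * l - c - ε)
    (hρl : l - ε ≤ ρ) (hlρ : l < (1 + θ) * ρ) (hρ : φ =O[atBot] fun t => Real.exp (ρ * t)) :
    ∃ A, (fun t => φ t - A * Real.exp (l * t))
      =O[atBot] fun t => Real.exp ((1 + θ) * ρ * t) := by
  set b := p * Real.exp (-(l * c * h))
  set v : ℝ → ℝ := fun t => φ t * Real.exp (-l * t)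
  have hv (t : ℝ) := hφ.hasDerivAt_mul_exp_neg hG l t
  have hb0 : 0 ≤ b := by positivity
  obtain ⟨C₀, hC₀⟩ := exists_isBigO_sub_const (hφ.hasDerivAt_divergence_form hG hχ)
    (show 0 < (1 + θ) * ρ + -l by linarith)
    (isBigO_mul_exp_atBot (-l) (hφ.isBigO_linearization_error hlin hch hρ))
  have hgap : 0 < 2 * l - c - b * (c * h) := by
    have : b * (c * h) ≤ b * (c * h) * Real.exp (ε * (c * h)) :=
      le_mul_of_one_le_right (by positivity) (Real.one_le_exp (by positivity))
    linarith
  obtain ⟨A, hA⟩ : ∃ A, A * (2 * l - c - b * (c * h)) = C₀ := ⟨_, div_mul_cancel₀ C₀ hgap.ne'⟩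
  have hsmall : (fun t => v t - A) =O[atBot] fun t => Real.exp (-ε * t) := by
    have hvε : v =O[atBot] fun t => Real.exp (-ε * t) :=
      (isBigO_mul_exp_atBot (-l) hρ).trans (isBigO_exp_exp_atBot (by linarith))
    have hone : (fun _ => (1 : ℝ)) =O[atBot] fun t => Real.exp (-ε * t) := by
      simpa only [zero_mul, Real.exp_zero] using isBigO_exp_exp_atBot (neg_nonpos.2 hε.le)
    exact hvε.sub ((isBigO_const_const A one_ne_zero _).trans hone)
  have hvcont : Continuous v := continuous_iff_continuousAt.2 fun t => (hv t).continuousAt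
  have hrefined : (fun t => v t - A) =O[atBot] fun t => Real.exp (((1 + θ) * ρ + -l) * t) := by
    refine isBigO_exp_of_delay_equation (fun t => (hv t).sub_const A) hb0 hch (by linarith) hε
      hcontract (hC₀.congr_left fun t => ?_) hsmall
    rw [intervalIntegral.integral_sub (hvcont.intervalIntegrable _ _)
      intervalIntegrable_const, intervalIntegral.integral_const, smul_eq_mul, sub_sub_cancel]
    linear_combination hA
  refine ⟨A, (isBigO_mul_exp_atBot l hrefined).congr (fun t => ?_) fun t => by
    rw [neg_add_cancel_right]⟩
  rw [sub_mul, mul_assoc, ← Real.exp_add, neg_mul, neg_add_cancel, Real.exp_zero, mul_one]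

lemma not_isBigO_exp_of_growthRate_lt (hG : Reaction G κ L) (hφ : MonotoneFront G κ c h φ)
    (hρ : growthRate c < ρ) : ¬ φ =O[atBot] fun t => Real.exp (ρ * t) := by
  intro hbound
  have hlower : (fun t => φ 0 * Real.exp (growthRate c * t)) =O[atBot] φ := by
    refine .of_bound 1 ?_
    filter_upwards [eventually_le_atBot 0] with t ht
    have hgrowth := hφ.le_mul_exp hG t (neg_nonneg.2 ht)
    rw [add_neg_cancel, mul_neg, Real.exp_neg] at hgrowth
    rw [one_mul, Real.norm_of_nonneg (hφ.mem_Icc t).1,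
      Real.norm_of_nonneg (mul_nonneg (hφ.mem_Icc 0).1 (Real.exp_pos _).le)]
    rwa [← div_eq_mul_inv, le_div_iff₀ (Real.exp_pos _)] at hgrowth
  exact (hφ.pos hG 0).ne' (eq_zero_of_isBigO_exp_atBot hρ (hlower.trans hbound))

/-- A front decaying faster than the eigenfunction would decay at all rates `(1 + θ)ⁿ ρ`. -/
lemma not_isBigO_exp (hG : Reaction G κ L) (hlin : HolderLinearization G p δ C θ)
    (hφ : MonotoneFront G κ c h φ) (hch : 0 ≤ c * h) (hp : 0 ≤ p) (hl : 0 < l)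
    (hχ : charFun p h c l = 0) (hε : 0 < ε)
    (hcontract : p * Real.exp (-(l * c * h)) * (c * h) * Real.exp (ε * (c * h)) < 2 * l - c - ε)
    (hlρ : l < ρ) : ¬ φ =O[atBot] fun t => Real.exp (ρ * t) := by
  intro hbound
  have hθ := hlin.theta_pos
  have hiter (n : ℕ) : φ =O[atBot] fun t => Real.exp ((1 + θ) ^ n * ρ * t) := by
    induction n with
    | zero => simpa only [pow_zero, one_mul] using hbound
    | succ n ih =>
      set r := (1 + θ) ^ n * ρ with hr
      have hlr : l < r :=
        hlρ.trans_le (le_mul_of_one_le_left (by linarith) (one_le_pow₀ (by linarith)))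
      have hr' : r < (1 + θ) * r := by linarith [mul_pos hθ (hl.trans hlr)]
      obtain ⟨A, hA⟩ := hφ.exists_isBigO_sub_mul_exp hG hlin hch hp hχ hε hcontract
        (by linarith) (hlr.trans hr') ih
      have hA0 : A = 0 := by
        refine eq_zero_of_isBigO_exp_atBot hlr ?_
        simpa only [sub_sub_cancel] using ih.sub (hA.trans (isBigO_exp_exp_atBot hr'.le))
      rw [pow_succ', mul_assoc (1 + θ), ← hr]
      simpa only [hA0, zero_mul, sub_zero] using hA
  obtain ⟨n, hn⟩ := pow_unbounded_of_one_lt (growthRate c / ρ) (show 1 < 1 + θ by linarith)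
  exact hφ.not_isBigO_exp_of_growthRate_lt hG ((div_lt_iff₀ (hl.trans hlρ)).1 hn) (hiter n)

lemma exists_isBigO_sub_exp_of_pos {f : ℝ → ℝ} {A r : ℝ} (hA : 0 < A) (hl : 0 < l)
    (hf : (fun t => f t - A * Real.exp (l * t)) =O[atBot] fun t => Real.exp (r * t)) :
    ∃ s₀, (fun t => f (t + s₀) - Real.exp (l * t)) =O[atBot] fun t => Real.exp (r * t) := by
  set s₀ := -Real.log A / l
  have hs₀ (t : ℝ) : A * Real.exp (l * (t + s₀)) = Real.exp (l * t) := by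
    rw [mul_add, mul_div_cancel₀ _ hl.ne', Real.exp_add, Real.exp_neg, Real.exp_log hA]
    field_simp
  have hshift := hf.comp_tendsto (tendsto_atBot_add_const_right atBot s₀ tendsto_id)
  simp only [Function.comp_def, id, hs₀] at hshift
  refine ⟨s₀, hshift.trans ((isBigO_const_mul_self (Real.exp (r * s₀)) _ _).congr_left
    fun t => ?_)⟩
  rw [← Real.exp_add]
  ring_nf

lemma exists_contraction_exponent {l₁ : ℝ} (hl₁ : 0 < l₁) (hl : l₁ < l) (hθ : 0 < θ)
    (hχ' : p * Real.exp (-(l * c * h)) * (c * h) < 2 * l - c) :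
    ∃ ε > 0, l₁ < l - ε ∧ l < (1 + θ) * (l - ε) ∧
      p * Real.exp (-(l * c * h)) * (c * h) * Real.exp (ε * (c * h)) < 2 * l - c - ε := by
  have hleft : ∀ᶠ ε in 𝓝 (0 : ℝ), l₁ < l - ε :=
    (Continuous.tendsto' (by fun_prop) 0 l (sub_zero l)).eventually_const_lt hl
  have hgain : ∀ᶠ ε in 𝓝 (0 : ℝ), l < (1 + θ) * (l - ε) :=
    (Continuous.tendsto' (by fun_prop) 0 ((1 + θ) * l) (by rw [sub_zero])).eventually_const_lt
      (by linarith [mul_pos hθ (hl₁.trans hl)])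
  have hcontract : ∀ᶠ ε in 𝓝 (0 : ℝ),
      p * Real.exp (-(l * c * h)) * (c * h) * Real.exp (ε * (c * h)) + ε < 2 * l - c :=
    (Continuous.tendsto' (by fun_prop) 0 (p * Real.exp (-(l * c * h)) * (c * h))
      (by simp only [zero_mul, Real.exp_zero, mul_one, add_zero])).eventually_lt_const hχ'
  obtain ⟨ε, ⟨h₁, h₂, h₃⟩, hε : 0 < ε⟩ := (((hleft.and (hgain.and hcontract)).filter_mono
    nhdsWithin_le_nhds).and (self_mem_nhdsWithin (s := Ioi 0))).exists
  exact ⟨ε, hε, h₁, h₂, by linarith⟩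

theorem exists_isBigO_sub_exp (hG : Reaction G κ L) (hlin : HolderLinearization G p δ C θ)
    (hφ : MonotoneFront G κ c h φ) (hch : 0 ≤ c * h) (hp : 0 ≤ p) {l₁ : ℝ}
    (hroots : ArePositiveRoots p h c l₁ l)
    (hfast : ∀ z ∈ Ioo l₁ l, φ =O[atBot] fun t => Real.exp (z * t)) :
    ∃ s₀ ς : ℝ, 0 < ς ∧
      (fun t => φ (t + s₀) - Real.exp (l * t)) =O[atBot] fun t => Real.exp ((l + ς) * t) := by
  have hl : 0 < l := hroots.1.trans hroots.2.1
  obtain ⟨ε, hε, hlε, hgain, hcontract⟩ := exists_contraction_exponent hroots.1 hroots.2.1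
    hlin.theta_pos (hroots.mul_exp_mul_lt hp)
  obtain ⟨A, hA⟩ := hφ.exists_isBigO_sub_mul_exp hG hlin hch hp hroots.charFun_right hε hcontract
    le_rfl hgain (hfast _ ⟨hlε, by linarith⟩)
  have hApos : 0 < A := by
    by_contra! hA0
    refine hφ.not_isBigO_exp hG hlin hch hp hl hroots.charFun_right hε hcontract hgain
      (.trans (.of_bound 1 (Eventually.of_forall fun t => ?_)) hA)
    have hterm := mul_nonpos_of_nonpos_of_nonneg hA0 (Real.exp_pos (l * t)).le
    rw [one_mul, Real.norm_of_nonneg (hφ.mem_Icc t).1]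
    exact le_trans (by linarith) (le_abs_self _)
  obtain ⟨s₀, hs₀⟩ := exists_isBigO_sub_exp_of_pos hApos hl hA
  exact ⟨s₀, (1 + θ) * (l - ε) - l, sub_pos.2 hgain, by rwa [add_sub_cancel]⟩

end MonotoneFront

end Asymptotics

section BirthFunction

/-- The birth function with its argument clamped to `[0, κ]`. Fronts only see the values of `g` on
this interval, and `clamped g κ` is a `Reaction` when `g` is monostable and nondecreasing. -/
noncomputable def clamped (g : ℝ → ℝ) (κ u : ℝ) : ℝ := g (max 0 (min κ u))

variable {g : ℝ → ℝ} {κ c h : ℝ} {L : ℝ≥0} {φ : ℝ → ℝ}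

lemma clamped_of_mem_Icc {u : ℝ} (hu : u ∈ Icc 0 κ) : clamped g κ u = g u := by
  rw [clamped, min_eq_right hu.2, max_eq_right hu.1]

lemma clamp_mem_Icc (hκ : 0 ≤ κ) (u : ℝ) : max 0 (min κ u) ∈ Icc 0 κ :=
  ⟨le_max_left _ _, max_le hκ (min_le_left _ _)⟩

lemma monotone_clamp (κ : ℝ) : Monotone fun u => max 0 (min κ u) :=
  monotone_const.max (monotone_const.min monotone_id)

lemma lipschitzWith_clamp (κ : ℝ) : LipschitzWith 1 fun u => max 0 (min κ u) :=
  (LipschitzWith.id.const_min κ).const_max 0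

namespace Monostable

lemma map_zero (hg : Monostable g κ) : g 0 = 0 := (hg.fixed_iff 0 le_rfl).2 (.inl rfl)

lemma map_kappa (hg : Monostable g κ) : g κ = κ := (hg.fixed_iff κ hg.kappa_pos.le).2 (.inr rfl)

lemma eventually_lt_map (hg : Monostable g κ) : ∀ᶠ u in 𝓝[>] 0, u < g u := by
  have hderiv : HasDerivWithinAt g (birthDeriv g 0) (Ici 0) 0 :=
    (differentiableWithinAt_of_derivWithin_ne_zero
      (zero_lt_one.trans hg.one_lt_deriv_zero).ne').hasDerivWithinAt
  have hslope := hasDerivWithinAt_iff_tendsto_slope.1 hderiv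
  rw [Ici_sdiff_left] at hslope
  filter_upwards [hslope.eventually_const_lt hg.one_lt_deriv_zero, self_mem_nhdsWithin]
    with u hu hu0
  rwa [slope_def_field, hg.map_zero, sub_zero, sub_zero, lt_div_iff₀ hu0, one_mul] at hu

lemma lt_map (hg : Monostable g κ) {u : ℝ} (h0 : 0 < u) (h1 : u < κ) : u < g u := by
  obtain ⟨x, hx, hx0, hxu⟩ := (hg.eventually_lt_map.and (Ioo_mem_nhdsGT h0)).exists
  by_contra! hgu
  have hcont : ContinuousOn (fun y => g y - y) (Icc x u) :=
    (hg.continuousOn.mono fun y hy => hx0.le.trans hy.1).sub continuousOn_id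
  obtain ⟨y, hy, hy0⟩ : ∃ y ∈ Icc x u, g y - y = 0 :=
    intermediate_value_Icc' hxu.le hcont ⟨sub_nonpos.2 hgu, (sub_pos.2 hx).le⟩
  rcases (hg.fixed_iff y (hx0.le.trans hy.1)).1 (sub_eq_zero.1 hy0) with rfl | rfl
  · exact hx0.not_ge hy.1
  · exact h1.not_ge hy.2

lemma exists_reaction_clamped (hg : Monostable g κ) (hmono : MonotoneOn g (Ici 0)) :
    ∃ L, Reaction (clamped g κ) κ L := by
  obtain ⟨K, hK⟩ := hg.lipschitz
  have hκ := hg.kappa_pos.le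
  have hclamp := clamp_mem_Icc hκ
  refine ⟨K, hg.kappa_pos, fun u v huv => hmono (hclamp u).1 (hclamp v).1 (monotone_clamp κ huv),
    ?_, ?_, ?_, fun u => hg.mapsTo (hclamp u).1, fun u => ?_, fun u h0 h1 => ?_⟩
  · have := hK.comp ((lipschitzWith_clamp κ).lipschitzOnWith (s := univ)) fun u _ => hclamp u
    rwa [mul_one, lipschitzOnWith_univ] at this
  · rw [clamped_of_mem_Icc ⟨le_rfl, hκ⟩, hg.map_zero]
  · rw [clamped_of_mem_Icc ⟨hκ, le_rfl⟩, hg.map_kappa]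
  · exact (hmono (hclamp u).1 hκ (hclamp u).2).trans_eq hg.map_kappa
  · rw [clamped_of_mem_Icc ⟨h0.le, h1.le⟩]
    exact hg.lt_map h0 h1

lemma exists_holderLinearization (hg : Monostable g κ) :
    ∃ δ C θ, HolderLinearization (clamped g κ) (birthDeriv g 0) δ C θ := by
  obtain ⟨δ₀, hδ₀, hδκ, hsmooth, -, C, θ, hC, hθ, -, hholder⟩ := hg.regular
  refine ⟨δ₀ / 2, C, θ, half_pos hδ₀, hC.le, hθ, fun u hu0 huδ => ?_⟩
  rw [clamped_of_mem_Icc ⟨hu0, by linarith⟩]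
  rcases hu0.eq_or_lt with rfl | hu
  · simp [hg.map_zero, Real.zero_rpow (by linarith : 1 + θ ≠ 0)]
  obtain ⟨ξ, ⟨hξ0, hξu⟩, hξ⟩ := exists_deriv_eq_slope g hu (hg.continuousOn.mono fun y hy => hy.1)
    fun y hy => ((hsmooth.differentiableOn one_ne_zero).differentiableAt
      (Ico_mem_nhds hy.1 (by linarith [hy.2]))).differentiableWithinAt
  rw [hg.map_zero, sub_zero, sub_zero, eq_div_iff hu.ne',
    ← derivWithin_of_mem_nhds (Ici_mem_nhds hξ0)] at hξ
  have hslope : |birthDeriv g ξ - birthDeriv g 0| ≤ C * u ^ θ := by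
    refine (le_add_of_nonneg_right (abs_nonneg _)).trans
      ((hholder ξ ⟨hξ0, by linarith⟩).trans ?_)
    gcongr
  calc |g u - birthDeriv g 0 * u| = |birthDeriv g ξ - birthDeriv g 0| * u := by
        rw [← hξ, ← birthDeriv, ← sub_mul, abs_mul, abs_of_pos hu]
    _ ≤ C * u ^ θ * u := by gcongr
    _ = C * u ^ (1 + θ) := by rw [Real.rpow_add hu, Real.rpow_one]; ring

lemma hasStrictDerivAt_kappa (hg : Monostable g κ) :
    HasStrictDerivAt g (birthDeriv g κ) κ := by
  obtain ⟨δ₀, hδ₀, -, -, hsmooth, -⟩ := hg.regular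
  rw [birthDeriv, derivWithin_of_mem_nhds (Ici_mem_nhds hg.kappa_pos)]
  exact (hsmooth.contDiffAt (Ioo_mem_nhds (by linarith) (by linarith))).hasStrictDerivAt
    one_ne_zero

lemma exists_map_sub_map_le (hg : Monostable g κ) : ∃ δ γ : ℝ, 0 < δ ∧ 0 ≤ γ ∧ γ < 1 ∧
    ∀ u ∈ Icc (κ - δ) κ, ∀ v ∈ Icc u κ, g v - g u ≤ γ * (v - u) := by
  have hlt := hg.deriv_kappa_lt_one
  obtain ⟨δ, hδ, hstrict⟩ := Metric.eventually_nhds_iff.1 (hg.hasStrictDerivAt_kappa.isLittleO.def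
    (show 0 < (1 - birthDeriv g κ) / 2 by linarith))
  refine ⟨δ / 2, max 0 ((1 + birthDeriv g κ) / 2), half_pos hδ, le_max_left _ _,
    max_lt one_pos (by linarith), fun u hu v hv => ?_⟩
  have hnear : ∀ w ∈ Icc (κ - δ / 2) κ, dist w κ < δ := fun w hw => by
    rw [Real.dist_eq, abs_lt]; constructor <;> linarith [hw.1, hw.2]
  have hsecant := hstrict (y := (v, u)) (max_lt (hnear v ⟨hu.1.trans hv.1, hv.2⟩) (hnear u hu))
  have huv : 0 ≤ v - u := sub_nonneg.2 hv.1
  simp only [ContinuousLinearMap.toSpanSingleton_apply, smul_eq_mul, Real.norm_eq_abs,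
    abs_of_nonneg huv] at hsecant
  calc g v - g u ≤ (1 + birthDeriv g κ) / 2 * (v - u) := by linarith [(abs_le.1 hsecant).2]
    _ ≤ max 0 ((1 + birthDeriv g κ) / 2) * (v - u) := by gcongr; exact le_max_right _ _

lemma exists_clamped_add_le (hg : Monostable g κ) : ∃ δ γ : ℝ, 0 < δ ∧ γ < 1 ∧
    ∀ u v, κ - δ ≤ u → 0 ≤ v → clamped g κ (u + v) ≤ clamped g κ u + γ * v := by
  obtain ⟨δ, γ, hδ, hγ0, hγ1, hsecant⟩ := hg.exists_map_sub_map_le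
  refine ⟨δ, γ, hδ, hγ1, fun u v hu hv => ?_⟩
  have hmem := clamp_mem_Icc hg.kappa_pos.le
  have hle : max 0 (min κ u) ≤ max 0 (min κ (u + v)) :=
    monotone_clamp κ (le_add_of_nonneg_right hv)
  have hstep : max 0 (min κ (u + v)) - max 0 (min κ u) ≤ v := by
    have := (lipschitzWith_clamp κ).dist_le_mul (u + v) u
    rw [Real.dist_eq, Real.dist_eq, add_sub_cancel_left, abs_of_nonneg hv, NNReal.coe_one,
      one_mul] at this
    exact (le_abs_self _).trans this
  have hclose : κ - δ ≤ max 0 (min κ u) := le_max_of_le_right (le_min (by linarith) hu)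
  rw [← sub_le_iff_le_add']
  calc clamped g κ (u + v) - clamped g κ u
      ≤ γ * (max 0 (min κ (u + v)) - max 0 (min κ u)) :=
        hsecant _ ⟨hclose, (hmem u).2⟩ _ ⟨hle, (hmem (u + v)).2⟩
    _ ≤ γ * v := by gcongr

end Monostable

lemma solvesDelayedEquation_iff : SolvesDelayedEquation g h (fun t x => φ (x + c * t)) ↔
    ∀ t, c * deriv φ t = deriv (deriv φ) t - φ t + g (φ (t - c * h)) := by
  have htime (t x : ℝ) : deriv (fun s => φ (x + c * s)) t = c * deriv φ (x + c * t) := by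
    rw [deriv_comp_mul_left c (fun y => φ (x + y)), deriv_comp_const_add, smul_eq_mul]
  have hspace (t x : ℝ) :
      iteratedDeriv 2 (fun y => φ (y + c * t)) x = deriv (deriv φ) (x + c * t) := by
    rw [iteratedDeriv_comp_add_const, iteratedDeriv_succ, iteratedDeriv_one]
  simp only [SolvesDelayedEquation, htime, hspace, mul_sub, ← add_sub_assoc]
  exact ⟨fun H t => by simpa using H 0 t, fun H t x => H (x + c * t)⟩

lemma MonotoneFront.isWavefront (hG : Reaction (clamped g κ) κ L)
    (hφ : MonotoneFront (clamped g κ) κ c h φ) : IsWavefront g κ h c φ := by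
  have hderiv₂ : deriv (deriv φ) = fun t => c * deriv φ t + φ t - clamped g κ (φ (t - c * h)) :=
    funext fun t => (hφ.hasDerivAt_deriv hG t).deriv
  have hdiff : Differentiable ℝ φ := fun t => (hφ.hasDerivAt hG t).differentiableAt
  have hdiff' : Differentiable ℝ (deriv φ) :=
    fun t => (hφ.hasDerivAt_deriv hG t).differentiableAt
  have hcont : Continuous (deriv (deriv φ)) := by
    rw [hderiv₂]
    exact ((hdiff'.continuous.const_mul c).add hφ.continuous).sub (hφ.continuous_delay hG)
  refine ⟨?_, hφ.pos hG, solvesDelayedEquation_iff.2 fun t => ?_, hφ.tendsto_atBot,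
    hφ.tendsto_atTop⟩
  · exact contDiff_succ_iff_deriv (n := 1).2
      ⟨hdiff, by simp, contDiff_one_iff_deriv.2 ⟨hdiff', hcont⟩⟩
  · simp only [hderiv₂, clamped_of_mem_Icc (hφ.mem_Icc _)]
    ring

lemma IsWavefront.isSupersolution (hκ : 0 < κ) (hmono : MonotoneOn g (Ici 0))
    (hφ : IsWavefront g κ h c φ) : IsSupersolution (clamped g κ) κ c h φ := by
  have hdiff' : Differentiable ℝ (deriv φ) :=
    (contDiff_succ_iff_deriv (n := 1).1 hφ.smooth).2.2.differentiable one_ne_zero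
  refine ⟨hφ.smooth.continuous, fun t => (hφ.pos t).le,
    fun r hr => hφ.tendsto_atTop.eventually_const_lt hr,
    (hφ.tendsto_atBot.eventually_lt_const hκ).exists, fun t _ => ⟨φ, rfl,
    .of_forall fun _ => le_rfl, le_rfl, deriv φ, deriv (deriv φ) t,
    .of_forall fun s => (hφ.smooth.differentiable two_ne_zero s).hasDerivAt,
    (hdiff' t).hasDerivAt, ?_⟩⟩
  have hpos := (hφ.pos (t - c * h)).le
  have hclamped : clamped g κ (φ (t - c * h)) ≤ g (φ (t - c * h)) :=
    hmono (mem_Ici.2 (le_max_left _ _)) hpos (max_le hpos (min_le_right _ _))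
  linarith [solvesDelayedEquation_iff.1 hφ.solves t]

lemma mem_admissibleSpeeds_iff (hG : Reaction (clamped g κ) κ L)
    (hmono : MonotoneOn g (Ici 0)) :
    c ∈ admissibleSpeeds g κ h ↔ 0 < c ∧ c ∈ frontSpeeds (clamped g κ) κ h :=
  and_congr_right fun _ =>
    ⟨fun ⟨_, hφ⟩ => exists_monotoneFront_of_isSupersolution hG
      (hφ.isSupersolution hG.kappa_pos hmono), fun ⟨φ, hφ⟩ => ⟨φ, hφ.isWavefront hG⟩⟩

end BirthFunction

section PushedFronts

variable {G : ℝ → ℝ} {κ c h : ℝ} {L : ℝ≥0} {φ : ℝ → ℝ}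

lemma HolderLinearization.exists_map_le_mul {p q δ C θ : ℝ} (hlin : HolderLinearization G p δ C θ)
    (hpq : p < q) : ∃ η, 0 < η ∧ ∀ u, 0 ≤ u → u ≤ η → G u ≤ q * u := by
  have hθ := hlin.theta_pos
  have hC := hlin.const_nonneg
  have hsmall : ∀ᶠ η in 𝓝[>] (0 : ℝ), C * η ^ θ < q - p := nhdsWithin_le_nhds <|
    (((Real.continuousAt_rpow_const 0 θ (.inr hθ.le)).const_mul C).eventually_lt_const
      (by simpa [Real.zero_rpow hθ.ne'] using hpq))
  obtain ⟨η, hη, hη0, hηδ⟩ := (hsmall.and (Ioo_mem_nhdsGT hlin.delta_pos)).exists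
  refine ⟨η, hη0, fun u hu0 huη => ?_⟩
  have herror : C * u ^ (1 + θ) ≤ (q - p) * u := by
    calc C * u ^ (1 + θ) = C * u ^ θ * u := by
          rw [add_comm, Real.rpow_add_one' hu0 (by linarith), mul_assoc]
      _ ≤ C * η ^ θ * u := by gcongr
      _ ≤ (q - p) * u := by gcongr
  linarith [(abs_le.1 (hlin.abs_sub_le u hu0 (huη.trans hηδ.le))).2]

lemma exists_charFun_neg_of_slope_gt {p z : ℝ} (hneg : charFun p h c z < 0) :
    ∃ q, p < q ∧ charFun q h c z < 0 := by
  have hcont : Continuous fun q => charFun q h c z := by unfold charFun; fun_prop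
  exact ((hcont.tendsto p).eventually_lt_const hneg).exists_gt

/-- Otherwise a slower front would exist. -/
lemma MonotoneFront.isBigO_exp_of_mem_lowerBounds (hG : Reaction G κ L) {p δ C θ η γ : ℝ}
    (hlin : HolderLinearization G p δ C θ) (hη : 0 < η) (hγ : γ < 1)
    (hkappa : ∀ u v, κ - η ≤ u → 0 ≤ v → G (u + v) ≤ G u + γ * v)
    (hφ : MonotoneFront G κ c h φ) (hmin : c ∈ lowerBounds (frontSpeeds G κ h))
    (hc : 0 < c) (hh : 0 ≤ h) {z : ℝ} (hz : 0 < z) (hneg : charFun p h c z < 0) :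
    φ =O[atBot] fun t => Real.exp (z * t) := by
  obtain ⟨q, hpq, hneg⟩ := exists_charFun_neg_of_slope_gt hneg
  obtain ⟨ρ, hρ, hzero⟩ := hlin.exists_map_le_mul hpq
  by_contra hslow
  have hfreq (X : ℝ) : ∃ᶠ t in atBot, X * Real.exp (z * t) < φ t := fun hX => by
    refine hslow (.of_bound X (hX.mono fun t ht => ?_))
    rw [Real.norm_of_nonneg (hφ.mem_Icc t).1, Real.norm_of_nonneg (Real.exp_pos _).le]
    exact not_lt.1 ht
  obtain ⟨c', hlt, hc'⟩ := hφ.exists_speed_lt hG hc hh hz hneg hρ hzero hη hγ hkappa hfreq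
  exact hlt.not_ge (hmin hc')

lemma Reaction.eventually_notMem_frontSpeeds (hG : Reaction G κ L)
    (hc : c ∉ frontSpeeds G κ h) : ∀ᶠ h' in 𝓝 h, c ∉ frontSpeeds G κ h' := by
  by_contra hfreq
  obtain ⟨u, hu, hfront⟩ := exists_seq_forall_of_frequently (not_eventually.1 hfreq)
  exact hc (exists_monotoneFront_of_tendsto (c := fun _ => c) hG tendsto_const_nhds hu
    fun n => not_not.1 (hfront n))

namespace Monostable

variable {g : ℝ → ℝ}

theorem exists_pushedFront (hg : Monostable g κ) (hmono : MonotoneOn g (Ici 0)) (hc : 0 < c)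
    (hh : 0 ≤ h) {z : ℝ} (hz : 0 < z) (hneg : charFun (birthDeriv g 0) h c z < 0)
    (hnot : c ∉ frontSpeeds (clamped g κ) κ h) :
    ∃ c φ, IsPushedFront g κ h c φ ∧ StrictMono φ ∧ HasPushedAsymptotics g h c φ := by
  obtain ⟨L, hG⟩ := hg.exists_reaction_clamped hmono
  obtain ⟨δ, C, θ, hlin⟩ := hg.exists_holderLinearization
  obtain ⟨η, γ, hη, hγ, hkappa⟩ := hg.exists_clamped_add_le
  have hp := hg.one_lt_deriv_zero
  have hp0 : 0 ≤ birthDeriv g 0 := by linarith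
  obtain ⟨cₘ, hcc, ⟨φ, hφ⟩, hmin⟩ := exists_isLeast_frontSpeeds hG hh hnot
  have hcₘ : 0 < cₘ := hc.trans hcc
  obtain ⟨cs, hcs, hcsc⟩ := exists_isLinearSpeed_lt hp hc.le hz hneg
  obtain ⟨y, hy, hyneg⟩ := hcs.exists_charFun_neg hp0 hh (hcsc.trans hcc)
  obtain ⟨l₁, l₂, hroots⟩ := exists_arePositiveRoots hp hcₘ.le hy hyneg
  have hfast : ∀ z ∈ Ioo l₁ l₂, φ =O[atBot] fun t => Real.exp (z * t) := fun z hz =>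
    hφ.isBigO_exp_of_mem_lowerBounds hG hlin hη hγ hkappa hmin hcₘ hh (hroots.1.trans hz.1)
      (hroots.charFun_neg hp0 hz)
  have hfront := hφ.isWavefront hG
  exact ⟨cₘ, φ, ⟨hfront, ⟨⟨hcₘ, φ, hfront⟩,
      fun c' hc' => hmin ((mem_admissibleSpeeds_iff hG hmono).1 hc').2⟩, cs, hcs, hcsc.trans hcc⟩,
    hφ.strictMono hG, l₁, l₂, hroots,
    hφ.exists_isBigO_sub_exp hG hlin (by positivity) hp0 hroots hfast⟩

/-- For a fixed speed `c`, both `c ≤ c_#(h)` and the existence of a front of speed `c` are closed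
conditions on `h`, so a speed strictly between `c_#` and `c_*` stays there when `h` varies. -/
theorem eventually_exists_pushedFront (hg : Monostable g κ) (hmono : MonotoneOn g (Ici 0))
    (hh : 0 ≤ h) (hpush : ∃ c φ, IsPushedFront g κ h c φ) : ∀ᶠ h' in 𝓝 h, 0 ≤ h' →
      ∃ c φ, IsPushedFront g κ h' c φ ∧ StrictMono φ ∧ HasPushedAsymptotics g h' c φ := by
  obtain ⟨c, φ, -, hmin, cs, hcs, hcsc⟩ := hpush
  obtain ⟨L, hG⟩ := hg.exists_reaction_clamped hmono
  have hp : 0 < birthDeriv g 0 := zero_lt_one.trans hg.one_lt_deriv_zero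
  obtain ⟨c₁, hcs₁, hc₁⟩ := exists_between hcsc
  have hc₁pos : 0 < c₁ := (hcs.pos hp.le hh).trans hcs₁
  obtain ⟨z, hz, hneg⟩ := hcs.exists_charFun_neg hp.le hh hcs₁
  have hnot : c₁ ∉ frontSpeeds (clamped g κ) κ h := fun hmem =>
    hc₁.not_ge (hmin.2 ((mem_admissibleSpeeds_iff hG hmono).2 ⟨hc₁pos, hmem⟩))
  have hcont : Continuous fun h' => charFun (birthDeriv g 0) h' c₁ z := by
    unfold charFun; fun_prop
  filter_upwards [hG.eventually_notMem_frontSpeeds hnot,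
    (hcont.tendsto h).eventually_lt_const hneg] with h' hnot' hneg' hh'
  exact hg.exists_pushedFront hmono hc₁pos hh' hz hneg' hnot'

end Monostable

end PushedFronts

section Energy

variable {G : ℝ → ℝ} {κ c : ℝ} {L : ℝ≥0} {φ : ℝ → ℝ}

lemma nonpos_of_deriv_nonpos_of_tendsto_atBot {f f' : ℝ → ℝ} (hf : ∀ t, HasDerivAt f (f' t) t)
    (hf' : ∀ t, f' t ≤ 0) (hlim : Tendsto f atBot (𝓝 0)) (t : ℝ) : f t ≤ 0 :=
  (antitone_of_hasDerivAt_nonpos hf hf').ge_of_tendsto hlim t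

namespace MonotoneFront

lemma tendsto_deriv_atBot {h : ℝ} (hG : Reaction G κ L) (hφ : MonotoneFront G κ c h φ) :
    Tendsto (deriv φ) atBot (𝓝 0) :=
  squeeze_zero hφ.deriv_nonneg (hφ.deriv_le hG)
    (by simpa using hφ.tendsto_atBot.const_mul (growthRate c))

lemma deriv_le_speed_mul (hG : Reaction G κ L) (hφ : MonotoneFront G κ c 0 φ) (t : ℝ) :
    deriv φ t ≤ c * φ t := by
  refine sub_nonpos.1 (nonpos_of_deriv_nonpos_of_tendsto_atBot
    (fun t => (hφ.hasDerivAt_deriv hG t).sub ((hφ.hasDerivAt hG t).const_mul c)) (fun t => ?_) ?_ t)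
  · rw [mul_zero, sub_zero]
    linarith [hG.le_map (hφ.mem_Icc t)]
  · have := (hφ.tendsto_deriv_atBot hG).sub (hφ.tendsto_atBot.const_mul c)
    rwa [mul_zero, sub_zero] at this

/-- The energy `φ'² / 2 + ∫₀^φ (G u - u) du - (c φ)² / 2` vanishes at `-∞` and is nonincreasing,
because `φ' ≤ c φ`. -/
lemma integral_sub_le (hG : Reaction G κ L) (hφ : MonotoneFront G κ c 0 φ) (hc : 0 ≤ c) :
    ∫ u in 0..κ, (G u - u) ≤ (c * κ) ^ 2 / 2 := by
  let Γ : ℝ → ℝ := fun x => (∫ u in 0..x, (G u - u)) - (c * x) ^ 2 / 2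
  have hΓ (x : ℝ) : HasDerivAt Γ (G x - x - c ^ 2 * x) x := by
    refine (((hG.continuous.sub continuous_id).integral_hasStrictDerivAt 0 x).hasDerivAt.sub
      ((((hasDerivAt_id x).const_mul c).pow 2).div_const 2)).congr_deriv ?_
    simp only [id_eq, Pi.sub_apply]
    ring
  have hΓcont : Continuous Γ := continuous_iff_continuousAt.2 fun x => (hΓ x).continuousAt
  have hΓzero : Γ 0 = 0 := by simp [Γ]
  have henergy : ∀ t, deriv φ t ^ 2 / 2 + Γ (φ t) ≤ 0 := by
    refine nonpos_of_deriv_nonpos_of_tendsto_atBot (fun t =>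
      (((hφ.hasDerivAt_deriv hG t).pow 2).div_const 2).add
        ((hΓ (φ t)).comp t (hφ.hasDerivAt hG t))) (fun t => ?_) ?_
    · have := mul_nonneg (mul_nonneg hc (hφ.deriv_nonneg t))
        (sub_nonneg.2 (hφ.deriv_le_speed_mul hG t))
      norm_num
      linarith
    · have := (((hφ.tendsto_deriv_atBot hG).pow 2).div_const 2).add
        ((hΓcont.tendsto 0).comp hφ.tendsto_atBot)
      simpa [hΓzero] using this
  have hΓκ : Γ κ ≤ 0 := le_of_tendsto' ((hΓcont.tendsto κ).comp hφ.tendsto_atTop) fun t => by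
    rw [Function.comp_apply]
    linarith [henergy t, sq_nonneg (deriv φ t)]
  exact sub_nonpos.1 hΓκ

end MonotoneFront

end Energy

section Example

variable {g : ℝ → ℝ} {κ : ℝ}

lemma birthDeriv_eq_deriv (hg : Differentiable ℝ g) {u : ℝ} (hu : 0 ≤ u) :
    birthDeriv g u = deriv g u :=
  (hg u).derivWithin (uniqueDiffOn_Ici 0 u hu)

lemma monostable_of_contDiff (hκ : 0 < κ) (hg : ContDiff ℝ 2 g) (hmaps : MapsTo g (Ici 0) (Ici 0))
    (hfixed : ∀ u, 0 ≤ u → (g u = u ↔ u = 0 ∨ u = κ)) (hzero : 1 < deriv g 0)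
    (hkappa : deriv g κ < 1) : Monostable g κ := by
  have hg₁ : ContDiff ℝ 1 g := hg.of_le one_le_two
  have hdiff : Differentiable ℝ g := hg₁.differentiable one_ne_zero
  obtain ⟨K, hK⟩ : ∃ K, LipschitzOnWith K (deriv g) (Icc 0 κ) :=
    ((contDiff_succ_iff_deriv (n := 1).1 hg).2.2.contDiffOn).exists_lipschitzOnWith one_ne_zero
      (convex_Icc 0 κ) isCompact_Icc
  refine ⟨hκ, hmaps, hg.continuous.continuousOn, hfixed, ?_, ?_, ?_, κ, hκ, le_rfl,
    hg₁.contDiffOn, hg₁.contDiffOn, 2 * K + 1, 1, by positivity, one_pos, le_rfl, fun u hu => ?_⟩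
  · exact hg₁.contDiffOn.exists_lipschitzOnWith one_ne_zero (convex_Icc 0 κ) isCompact_Icc
  · rwa [birthDeriv_eq_deriv hdiff le_rfl]
  · rwa [birthDeriv_eq_deriv hdiff hκ.le]
  have hnear_zero : |deriv g u - deriv g 0| ≤ K * u := by
    simpa [Real.dist_eq, abs_of_pos hu.1] using
      hK.dist_le_mul u ⟨hu.1.le, hu.2.le⟩ 0 ⟨le_rfl, hκ.le⟩
  have hnear_kappa : |deriv g κ - deriv g (κ - u)| ≤ K * u := by
    simpa [Real.dist_eq, abs_of_pos hu.1] using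
      hK.dist_le_mul κ ⟨hκ.le, le_rfl⟩ (κ - u) ⟨by linarith [hu.2], by linarith [hu.1]⟩
  rw [birthDeriv_eq_deriv hdiff hu.1.le, birthDeriv_eq_deriv hdiff le_rfl,
    birthDeriv_eq_deriv hdiff hκ.le, birthDeriv_eq_deriv hdiff (by linarith [hu.2]), Real.rpow_one]
  linarith [hu.1]

/-- A birth function with slope close to `1` at `0` but strong growth in the middle of `[0, 1]`:
the former makes the linear speed small, the latter makes slow fronts energetically impossible. -/
noncomputable def rationalBirth (u : ℝ) : ℝ := u + u * (1 - u) * (1 + 60 * u) / (120 * (1 + u ^ 2))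

lemma contDiff_rationalBirth : ContDiff ℝ 2 rationalBirth := by
  unfold rationalBirth
  fun_prop (disch := intros; positivity)

lemma hasDerivAt_rationalBirth (u : ℝ) : HasDerivAt rationalBirth
    ((121 + 118 * u + 59 * u ^ 2 + 60 * u ^ 4) / (120 * (1 + u ^ 2) ^ 2)) u := by
  have hnum : HasDerivAt (fun u : ℝ => u * (1 - u) * (1 + 60 * u))
      (1 + 118 * u - 180 * u ^ 2) u := by
    refine (((hasDerivAt_id u).mul ((hasDerivAt_id u).const_sub 1)).mul
      (((hasDerivAt_id u).const_mul 60).const_add 1)).congr_deriv ?_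
    simp only [id_eq, Pi.mul_apply]
    ring
  have hden : HasDerivAt (fun u : ℝ => 120 * (1 + u ^ 2)) (240 * u) u := by
    refine (((hasDerivAt_pow 2 u).const_add 1).const_mul 120).congr_deriv ?_
    push_cast
    ring
  refine ((hasDerivAt_id u).add (hnum.div hden (by positivity))).congr_deriv ?_
  field_simp
  ring

lemma monotoneOn_rationalBirth : MonotoneOn rationalBirth (Ici 0) := by
  refine monotoneOn_of_hasDerivWithinAt_nonneg (convex_Ici 0)
    contDiff_rationalBirth.continuous.continuousOn
    (fun u _ => (hasDerivAt_rationalBirth u).hasDerivWithinAt) fun u hu => ?_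
  have hu0 : 0 ≤ u := interior_subset hu
  positivity

lemma rationalBirth_eq_self_iff {u : ℝ} (hu : 0 ≤ u) : rationalBirth u = u ↔ u = 0 ∨ u = 1 := by
  have hpos : 1 + 60 * u ≠ 0 := by positivity
  have hden : 120 * (1 + u ^ 2) ≠ 0 := by positivity
  simp only [rationalBirth, add_eq_left, div_eq_zero_iff, mul_eq_zero, hpos, hden, or_false,
    sub_eq_zero, eq_comm (a := (1 : ℝ))]

lemma monostable_rationalBirth : Monostable rationalBirth 1 := by
  refine monostable_of_contDiff one_pos contDiff_rationalBirth (fun u hu => ?_)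
    (fun u => rationalBirth_eq_self_iff) ?_ ?_
  · simpa [rationalBirth] using monotoneOn_rationalBirth self_mem_Ici hu hu
  · rw [(hasDerivAt_rationalBirth 0).deriv]; norm_num
  · rw [(hasDerivAt_rationalBirth 1).deriv]; norm_num

lemma lt_integral_rationalBirth : 1 / 50 < ∫ u in (0 : ℝ)..1, (rationalBirth u - u) := by
  have hlower : ∀ u ∈ Icc (0 : ℝ) 1, u * (1 - u) * (1 + 60 * u) / 240 ≤ rationalBirth u - u := by
    intro u ⟨hu0, hu1⟩
    rw [rationalBirth, add_sub_cancel_left]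
    have := sub_nonneg.2 hu1
    gcongr
    nlinarith
  calc (1 / 50 : ℝ) < ∫ u in (0 : ℝ)..1, u * (1 - u) * (1 + 60 * u) / 240 := by
        have hexpand (u : ℝ) : u * (1 - u) * (1 + 60 * u) / 240
            = 1 / 240 * u ^ 1 + 59 / 240 * u ^ 2 - 1 / 4 * u ^ 3 := by ring
        simp only [hexpand]
        rw [intervalIntegral.integral_sub (Continuous.intervalIntegrable (by fun_prop) _ _)
          (Continuous.intervalIntegrable (by fun_prop) _ _),
          intervalIntegral.integral_add (Continuous.intervalIntegrable (by fun_prop) _ _)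
            (Continuous.intervalIntegrable (by fun_prop) _ _)]
        simp only [intervalIntegral.integral_const_mul, integral_pow]
        norm_num
    _ ≤ ∫ u in (0 : ℝ)..1, (rationalBirth u - u) :=
        intervalIntegral.integral_mono_on zero_le_one
          (Continuous.intervalIntegrable (by fun_prop) _ _)
          ((contDiff_rationalBirth.continuous.sub continuous_id).intervalIntegrable _ _) hlower

lemma notMem_frontSpeeds_rationalBirth : 1 / 5 ∉ frontSpeeds (clamped rationalBirth 1) 1 0 := by
  rintro ⟨φ, hφ⟩
  obtain ⟨L, hG⟩ := monostable_rationalBirth.exists_reaction_clamped monotoneOn_rationalBirth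
  have hclamped : ∫ u in (0 : ℝ)..1, (clamped rationalBirth 1 u - u)
      = ∫ u in (0 : ℝ)..1, (rationalBirth u - u) :=
    intervalIntegral.integral_congr fun u hu => by
      rw [uIcc_of_le zero_le_one] at hu
      simp only [clamped_of_mem_Icc hu]
  have := hφ.integral_sub_le hG (by norm_num)
  rw [hclamped] at this
  linarith [lt_integral_rationalBirth]

lemma exists_pushedFront_rationalBirth : ∃ c φ, IsPushedFront rationalBirth 1 0 c φ := by
  have hneg : charFun (birthDeriv rationalBirth 0) 0 (1 / 5) (1 / 10) < 0 := by
    rw [birthDeriv_eq_deriv (contDiff_rationalBirth.differentiable two_ne_zero) le_rfl,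
      (hasDerivAt_rationalBirth 0).deriv, charFun]
    norm_num
  obtain ⟨c, φ, h, -⟩ := monostable_rationalBirth.exists_pushedFront monotoneOn_rationalBirth
    (by norm_num) le_rfl (by norm_num) hneg notMem_frontSpeeds_rationalBirth
  exact ⟨c, φ, h⟩

end Example

end DelayedFront

theorem proposition1 :
    (∀ (g : ℝ → ℝ) (κ : ℝ), DelayedFront.Monostable g κ → MonotoneOn g (Set.Ici 0) →
      ∀ (h₀ : ℝ), 0 ≤ h₀ →
      (∃ (c : ℝ) (φ : ℝ → ℝ), DelayedFront.IsPushedFront g κ h₀ c φ) →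
      ∃ δ : ℝ, 0 < δ ∧
        (∀ h ∈ Set.Ioo (h₀ - δ) (h₀ + δ), 0 ≤ h →
          ∃ (c : ℝ) (φ : ℝ → ℝ), DelayedFront.IsPushedFront g κ h c φ) ∧
        (∃ h ∈ Set.Ioo (h₀ - δ) (h₀ + δ), 0 < h ∧
          ∃ (c : ℝ) (φ : ℝ → ℝ), DelayedFront.IsPushedFront g κ h c φ ∧ StrictMono φ ∧
            DelayedFront.HasPushedAsymptotics g h c φ)) ∧
    (∃ (g : ℝ → ℝ) (κ : ℝ), DelayedFront.Monostable g κ ∧ MonotoneOn g (Set.Ici 0) ∧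
      ∃ h : ℝ, 0 < h ∧
        ∃ (c : ℝ) (φ : ℝ → ℝ), DelayedFront.IsPushedFront g κ h c φ ∧ StrictMono φ ∧
          DelayedFront.HasPushedAsymptotics g h c φ) := by
  have hpersist (g : ℝ → ℝ) (κ : ℝ) (hg : DelayedFront.Monostable g κ)
      (hmono : MonotoneOn g (Set.Ici 0)) (h₀ : ℝ) (hh₀ : 0 ≤ h₀)
      (hpush : ∃ c φ, DelayedFront.IsPushedFront g κ h₀ c φ) :
      ∃ δ > 0, ∀ h ∈ Set.Ioo (h₀ - δ) (h₀ + δ), 0 ≤ h →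
        ∃ c φ, DelayedFront.IsPushedFront g κ h c φ ∧ StrictMono φ ∧
          DelayedFront.HasPushedAsymptotics g h c φ :=
    (nhds_basis_Ioo_pos h₀).eventually_iff.1 (hg.eventually_exists_pushedFront hmono hh₀ hpush)
  refine ⟨fun g κ hg hmono h₀ hh₀ hpush => ?_, DelayedFront.rationalBirth, 1,
    DelayedFront.monostable_rationalBirth, DelayedFront.monotoneOn_rationalBirth, ?_⟩
  · obtain ⟨δ, hδ, hfront⟩ := hpersist g κ hg hmono h₀ hh₀ hpush
    refine ⟨δ, hδ, fun h hh hh0 => ?_, h₀ + δ / 2, ⟨by linarith, by linarith⟩, by linarith,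
      hfront _ ⟨by linarith, by linarith⟩ (by linarith)⟩
    obtain ⟨c, φ, hφ, -⟩ := hfront h hh hh0
    exact ⟨c, φ, hφ⟩
  · obtain ⟨δ, hδ, hfront⟩ := hpersist _ 1 DelayedFront.monostable_rationalBirth
      DelayedFront.monotoneOn_rationalBirth 0 le_rfl DelayedFront.exists_pushedFront_rationalBirth
    exact ⟨δ / 2, by linarith, hfront _ ⟨by linarith, by linarith⟩ (by linarith)⟩
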